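/- **Exact solution of the adjoint diffusion SDEs.** Let $T>0$ and let $\alpha,\sigma:[0,T]\to\mathbb R$ be a noise schedule: $\alpha$ is $C^1$ and positive on $[0,T]$; $\sigma$ is continuous on $[0,T]$, and $C^1$ and positive on $(0,T]$ (so $\sigma_0=0$ is allowed); and $\lambda_t:=\log(\alpha_t/\sigma_t)$ is strictly decreasing on $(0,T]$. Let $t_\lambda$ be the inverse function of $t\mapsto\lambda_t$, and put $$f(t)=\frac{\mathrm d\log\alpha_t}{\mathrm dt},\qquad g^2(t)=\frac{\mathrm d\sigma_t^2}{\mathrm dt}-2\,\frac{\mathrm d\log\alpha_t}{\mathrm dt}\,\sigma_t^2,\qquad g=\sqrt{g^2}$$ (the coefficients of the variance preserving diffusion SDE). Let $\boldsymbol\epsilon_\theta(\mathbf x,\mathbf z,t)\in\mathbb R^d$, for $\theta\in\mathbb R^p$, $\mathbf x\in\mathbb R^d$, $\mathbf z\in\mathbb R^m$, $t\in[0,T]$, be jointly continuous, with partial derivatives in $\mathbf x,\mathbf z,\theta$ that are jointly continuous, and Lipschitz in $\mathbf x$, uniformly in $t$ and locally uniformly in $(\mathbf z,\theta)$. Let $\mathcal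 L:\mathbb R^d\to\mathbb R$ be differentiable. Fix $\mathbf z$ and $\theta$, let $\bar{\mathbf w}$ be a standard $d$-dimensional Wiener process running backwards in time from $T$ to $0$, and let $\mathbf x$ be a continuous solution on $[0,T]$, backwards in time from an arbitrary random $\mathbf x_T$, of the Itô diffusion SDE $$\mathrm d\mathbf x_t=\Big[f(t)\mathbf x_t+\frac{g^2(t)}{\sigma_t}\boldsymbol\epsilon_\theta(\mathbf x_t,\mathbf z,t)\Big]\mathrm dt+g(t)\,\mathrm d\bar{\mathbf w}_t .$$ Write $\boldsymbol f_\theta(\mathbf x,\mathbf z,t)$ for its drift and $\boldsymbol g_\theta(\mathbf x,\mathbf z,t)=g(t)\mathbf I$ for its diffusion matrix, and let $\Phi^{\theta,\mathbf z}_{t\to u}(\mathbf y)$, $u\le t$, be the stochastic flow of the SDE for the same realization of the noise (the value at time $u$ of the solution that is at $\mathbf y$ at time $t$, with parameters $\theta$ and condition $\mathbf z$). The adjoint states, as row vectors, are $$\mathbf a_{\mathbf x}(t)=\frac{\partial \mathcal L(\Phi^{\theta,\mathbf z}_{t\to0}(\mathbf y))}{\partial\mathbf y}\Big|_{\mathbf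 y=\mathbf x_t},\qquad \mathbf a_{\mathbf z}(t)=\frac{\partial \mathcal L(\Phi^{\theta,\mathbf z}_{t\to0}(\mathbf x_t))}{\partial\mathbf z},\qquad \mathbf a_\theta(t)=\frac{\partial \mathcal L(\Phi^{\theta,\mathbf z}_{t\to0}(\mathbf x_t))}{\partial\theta}$$ (in the last two $\mathbf x_t$ is held fixed). The *adjoint diffusion SDEs* are the Stratonovich equations $$\mathrm d\mathbf a_h(t)=-\mathbf a_{\mathbf x}(t)^\top\frac{\partial\boldsymbol f_\theta}{\partial h}(\mathbf x_t,\mathbf z,t)\,\mathrm dt-\mathbf a_{\mathbf x}(t)^\top\frac{\partial\boldsymbol g_\theta}{\partial h}(\mathbf x_t,\mathbf z,t)\circ\mathrm d\bar{\mathbf w}_t,\qquad h\in\{\mathbf x,\mathbf z,\theta\}.$$ Let $t\in(0,T)$. Then: 1. Almost surely the three derivatives that define the adjoint states exist at all times in $[0,T]$, and the adjoint states solve the adjoint diffusion SDEs on $[t,T]$. 2. For all random initial values $[\mathbf a_{\mathbf x}(t),\mathbf a_{\mathbf z}(t),\mathbf a_\theta(t)]$ the adjoint diffusion SDEs have a solution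 with continuous paths on $[t,T]$, and it is unique up to a null set. 3. Every solution of the adjoint diffusion SDEs on $[t,T]$ (in particular the adjoint states) satisfies, almost surely, for all $s\in(t,T]$, $$\mathbf a_{\mathbf x}(s)=\frac{\alpha_t}{\alpha_s}\mathbf a_{\mathbf x}(t)+\frac{2}{\alpha_s}\int_{\lambda_t}^{\lambda_s}\alpha_\lambda^2e^{-\lambda}\,\mathbf a_{\mathbf x}(\lambda)^\top\frac{\partial\boldsymbol\epsilon_\theta(\mathbf x_\lambda,\mathbf z,\lambda)}{\partial\mathbf x_\lambda}\,\mathrm d\lambda,$$ $$\mathbf a_{\mathbf z}(s)=\mathbf a_{\mathbf z}(t)+2\int_{\lambda_t}^{\lambda_s}\alpha_\lambda e^{-\lambda}\,\mathbf a_{\mathbf x}(\lambda)^\top\frac{\partial\boldsymbol\epsilon_\theta(\mathbf x_\lambda,\mathbf z,\lambda)}{\partial\mathbf z}\,\mathrm d\lambda,$$ $$\mathbf a_\theta(s)=\mathbf a_\theta(t)+2\int_{\lambda_t}^{\lambda_s}\alpha_\lambda e^{-\lambda}\,\mathbf a_{\mathbf x}(\lambda)^\top\frac{\partial\boldsymbol\epsilon_\theta(\mathbf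 x_\lambda,\mathbf z,\lambda)}{\partial\theta}\,\mathrm d\lambda,$$ where the integrands are integrable, and where a subscript or argument $\lambda$ stands for the time $t_\lambda(\lambda)$: $\alpha_\lambda=\alpha_{t_\lambda(\lambda)}$, $\mathbf x_\lambda=\mathbf x_{t_\lambda(\lambda)}$, $\mathbf a_{\mathbf x}(\lambda)=\mathbf a_{\mathbf x}(t_\lambda(\lambda))$, and so on. -/

import Mathlib

open Set MeasureTheory ProbabilityTheory
open scoped NNReal ENNReal

namespace AdjointDiffusion

noncomputable section

/-! ### Noise schedule and coefficients of the diffusion SDE -/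

/-- One half of the log-SNR, `λ_t = log (α_t / σ_t)`. -/
def halfLogSNR (α σ : ℝ → ℝ) (t : ℝ) : ℝ := Real.log (α t / σ t)

/-- The inverse function `t_λ` of `t ↦ λ_t` on `(0, T]`. -/
def timeOfLogSNR (T : ℝ) (α σ : ℝ → ℝ) : ℝ → ℝ :=
  Function.invFunOn (halfLogSNR α σ) (Ioc 0 T)

/-- A noise schedule on `[0, T]`: both coefficients are continuously differentiable and positive,
except that at time `0` the function `σ` only has to be continuous (typically `σ 0 = 0`, with an
infinite slope), and the log-SNR is strictly decreasing. -/
structure IsNoiseSchedule (T : ℝ) (α σ : ℝ → ℝ) : Prop where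
  contDiffOn_alpha : ContDiffOn ℝ 1 α (Icc 0 T)
  alpha_pos : ∀ t ∈ Icc 0 T, 0 < α t
  continuousOn_sigma : ContinuousOn σ (Icc 0 T)
  contDiffOn_sigma : ContDiffOn ℝ 1 σ (Ioc 0 T)
  sigma_pos : ∀ t ∈ Ioc 0 T, 0 < σ t
  strictAntiOn_halfLogSNR : StrictAntiOn (halfLogSNR α σ) (Ioc 0 T)

/-- `f(t) = d log α_t / dt` (one-sided at the end points of `[0, T]`). -/
def driftCoeff (T : ℝ) (α : ℝ → ℝ) (t : ℝ) : ℝ :=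
  derivWithin (fun u => Real.log (α u)) (Icc 0 T) t

/-- `g²(t) = d σ_t² / dt - 2 (d log α_t / dt) σ_t²`. -/
def diffusionCoeffSq (T : ℝ) (α σ : ℝ → ℝ) (t : ℝ) : ℝ :=
  derivWithin (fun u => σ u ^ 2) (Icc 0 T) t
    - 2 * derivWithin (fun u => Real.log (α u)) (Icc 0 T) t * σ t ^ 2

/-- The diffusion coefficient `g(t) = √(g²(t))`. -/
def diffusionCoeff (T : ℝ) (α σ : ℝ → ℝ) (t : ℝ) : ℝ := Real.sqrt (diffusionCoeffSq T α σ t)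

section Model

variable {d m p : ℕ}

/-- Regularity of a noise prediction model `ε_θ(x, z, t)` (arguments in the order `θ, x, z, t`):
it is jointly continuous, it has partial derivatives with respect to `x`, `z`, `θ` which are jointly
continuous, and it is Lipschitz in `x`, uniformly in `t` and locally uniformly in `(z, θ)`. -/
structure IsRegularNoiseModel (T : ℝ)
    (ε : EuclideanSpace ℝ (Fin p) → EuclideanSpace ℝ (Fin d) → EuclideanSpace ℝ (Fin m) → ℝ →
      EuclideanSpace ℝ (Fin d)) : Prop where
  continuousOn : ContinuousOn
    (fun q : EuclideanSpace ℝ (Fin p) × EuclideanSpace ℝ (Fin d) × EuclideanSpace ℝ (Fin m) × ℝ =>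
      ε q.1 q.2.1 q.2.2.1 q.2.2.2) {q | q.2.2.2 ∈ Icc 0 T}
  differentiable_x : ∀ θ z, ∀ t ∈ Icc 0 T, Differentiable ℝ (fun x => ε θ x z t)
  differentiable_z : ∀ θ x, ∀ t ∈ Icc 0 T, Differentiable ℝ (fun z => ε θ x z t)
  differentiable_theta : ∀ x z, ∀ t ∈ Icc 0 T, Differentiable ℝ (fun θ => ε θ x z t)
  continuousOn_fderiv_x : ContinuousOn
    (fun q : EuclideanSpace ℝ (Fin p) × EuclideanSpace ℝ (Fin d) × EuclideanSpace ℝ (Fin m) × ℝ =>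
      fderiv ℝ (fun x => ε q.1 x q.2.2.1 q.2.2.2) q.2.1) {q | q.2.2.2 ∈ Icc 0 T}
  continuousOn_fderiv_z : ContinuousOn
    (fun q : EuclideanSpace ℝ (Fin p) × EuclideanSpace ℝ (Fin d) × EuclideanSpace ℝ (Fin m) × ℝ =>
      fderiv ℝ (fun z => ε q.1 q.2.1 z q.2.2.2) q.2.2.1) {q | q.2.2.2 ∈ Icc 0 T}
  continuousOn_fderiv_theta : ContinuousOn
    (fun q : EuclideanSpace ℝ (Fin p) × EuclideanSpace ℝ (Fin d) × EuclideanSpace ℝ (Fin m) × ℝ =>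
      fderiv ℝ (fun θ => ε θ q.2.1 q.2.2.1 q.2.2.2) q.1) {q | q.2.2.2 ∈ Icc 0 T}
  lipschitz_x : ∀ R : ℝ, ∃ C : ℝ, ∀ θ z x, ∀ t ∈ Icc 0 T, ‖θ‖ ≤ R → ‖z‖ ≤ R →
    ‖fderiv ℝ (fun y => ε θ y z t) x‖ ≤ C

/-- The drift `f(t) x + (g²(t) / σ_t) ε_θ(x, z, t)` of the diffusion SDE. -/
def sdeDrift (T : ℝ) (α σ : ℝ → ℝ)
    (ε : EuclideanSpace ℝ (Fin p) → EuclideanSpace ℝ (Fin d) → EuclideanSpace ℝ (Fin m) → ℝ →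
      EuclideanSpace ℝ (Fin d))
    (θ : EuclideanSpace ℝ (Fin p)) (x : EuclideanSpace ℝ (Fin d)) (z : EuclideanSpace ℝ (Fin m))
    (t : ℝ) : EuclideanSpace ℝ (Fin d) :=
  driftCoeff T α t • x + (diffusionCoeff T α σ t ^ 2 / σ t) • ε θ x z t

/-- The diffusion matrix `g(t) I` of the diffusion SDE, as a function of `θ, x, z, t`. -/
def sdeDiffusion (T : ℝ) (α σ : ℝ → ℝ) (_θ : EuclideanSpace ℝ (Fin p))
    (_x : EuclideanSpace ℝ (Fin d)) (_z : EuclideanSpace ℝ (Fin m)) (t : ℝ) :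
    EuclideanSpace ℝ (Fin d) →L[ℝ] EuclideanSpace ℝ (Fin d) :=
  diffusionCoeff T α σ t • ContinuousLinearMap.id ℝ (EuclideanSpace ℝ (Fin d))

end Model

/-! ### Wiener process and stochastic integrals -/

section Stochastic

variable {Ω : Type*} [MeasurableSpace Ω] {d : ℕ} {V : Type*} [NormedAddCommGroup V]
  [NormedSpace ℝ V]

/-- A standard `d`-dimensional Wiener process: independent real Brownian motions as coordinates. -/
structure IsWienerProcess (P : Measure Ω) (W : ℝ≥0 → Ω → EuclideanSpace ℝ (Fin d)) : Prop where
  brownian : ∀ i, IsBrownianReal (fun t ω => W t ω i) P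
  indep : iIndepFun (fun (i : Fin d) ω (t : ℝ≥0) => W t ω i) P

/-- The Wiener process run backwards in time from time `T`: `w̄_t = W_{T - t}` for `t ≤ T`. -/
def reverseWiener (T : ℝ) (W : ℝ≥0 → Ω → EuclideanSpace ℝ (Fin d)) (t : ℝ) :
    Ω → EuclideanSpace ℝ (Fin d) :=
  W (T - t).toNNReal

/-- `q 0 ≤ q 1 ≤ ⋯ ≤ q n` is a partition of `[s, t]`. -/
structure IsPartition (s t : ℝ) (n : ℕ) (q : ℕ → ℝ) : Prop where
  left : q 0 = s
  right : q n = t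
  mono : ∀ k < n, q k ≤ q (k + 1)

/-- The sums `S n q`, indexed by the partitions `q` of `[s, t]`, converge to `I` in probability as
the mesh tends to `0`. -/
def TendstoInProbability (P : Measure Ω) (s t : ℝ) (S : ℕ → (ℕ → ℝ) → Ω → V) (I : Ω → V) : Prop :=
  ∀ ε : ℝ, 0 < ε → ∀ η : ℝ, 0 < η → ∃ δ : ℝ, 0 < δ ∧ ∀ n q, IsPartition s t n q →
    (∀ k < n, q (k + 1) - q k < δ) → P {ω | ε ≤ ‖S n q ω - I ω‖} ≤ ENNReal.ofReal η

/-- `I` is the Itô integral of `Y` from `t` down to `s ≤ t` against a process `w` that runs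
backwards in time; the integrand is evaluated at the later time, where each step begins. -/
def IsBackwardItoIntegral (P : Measure Ω) (w : ℝ → Ω → EuclideanSpace ℝ (Fin d))
    (Y : ℝ → Ω → EuclideanSpace ℝ (Fin d) →L[ℝ] V) (t s : ℝ) (I : Ω → V) : Prop :=
  TendstoInProbability P s t
    (fun n q ω => ∑ k ∈ Finset.range n, Y (q (k + 1)) ω (w (q k) ω - w (q (k + 1)) ω)) I

/-- `I` is the Stratonovich integral `∫_s^t Y_u ∘ dw_u`, where `s ≤ t`. -/
def IsStratonovichIntegral (P : Measure Ω) (w : ℝ → Ω → EuclideanSpace ℝ (Fin d))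
    (Y : ℝ → Ω → EuclideanSpace ℝ (Fin d) →L[ℝ] V) (s t : ℝ) (I : Ω → V) : Prop :=
  TendstoInProbability P s t
    (fun n q ω => ∑ k ∈ Finset.range n,
      ((1 / 2 : ℝ) • (Y (q k) ω + Y (q (k + 1)) ω)) (w (q (k + 1)) ω - w (q k) ω)) I

/-- `N` is a version with continuous paths of the Itô integral process of the integrand `Y` on
`[0, T]` against the backward process `w`: `N_s - N_t = ∫_t^s Y_u dw_u` for `s ≤ t`. The integrand
is allowed to be singular at time `0`, which is reached by continuity. -/
structure IsBackwardItoProcess (P : Measure Ω) (w : ℝ → Ω → EuclideanSpace ℝ (Fin d))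
    (Y : ℝ → Ω → EuclideanSpace ℝ (Fin d) →L[ℝ] V) (T : ℝ) (N : ℝ → Ω → V) : Prop where
  continuousOn : ∀ᵐ ω ∂P, ContinuousOn (fun t => N t ω) (Icc 0 T)
  integral : ∀ s t, 0 < s → s ≤ t → t ≤ T →
    IsBackwardItoIntegral P w Y t s (fun ω => N s ω - N t ω)

/-- `a` solves `da = b dt + Y ∘ dw` on `[t, T]`, almost surely. -/
def SolvesStratonovich (P : Measure Ω) (w : ℝ → Ω → EuclideanSpace ℝ (Fin d)) (t T : ℝ)
    (a b : ℝ → Ω → V) (Y : ℝ → Ω → EuclideanSpace ℝ (Fin d) →L[ℝ] V) : Prop :=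
  (∀ᵐ ω ∂P, ContinuousOn (fun s => a s ω) (Icc t T)) ∧
  ∃ J : ℝ → Ω → V,
    (∀ᵐ ω ∂P, ContinuousOn (fun s => J s ω) (Icc t T)) ∧
    (∀ s ∈ Icc t T, IsStratonovichIntegral P w Y t s (J s)) ∧
    ∀ᵐ ω ∂P, ∀ s ∈ Icc t T,
      IntervalIntegrable (fun u => b u ω) volume t s ∧
      a s ω = a t ω + (∫ u in t..s, b u ω) + J s ω

end Stochastic

/-! ### Solutions of the diffusion SDE and its stochastic flow -/

section Flow

variable {d m p : ℕ}

/-- The path `x` solves `dx = F(x, u) du + dN` on `[s, t]` (in integrated form, backwards from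
time `t`). -/
def IsPathSolution (F : EuclideanSpace ℝ (Fin d) → ℝ → EuclideanSpace ℝ (Fin d))
    (N : ℝ → EuclideanSpace ℝ (Fin d)) (s t : ℝ) (x : ℝ → EuclideanSpace ℝ (Fin d)) : Prop :=
  ContinuousOn x (Icc s t) ∧ ∀ u ∈ Icc s t,
    IntervalIntegrable (fun v => F (x v) v) volume u t ∧
    x u = x t - (∫ v in u..t, F (x v) v) + (N u - N t)

variable {Ω : Type*} [MeasurableSpace Ω]

/-- `Φ θ z t y u ω` is the value at time `u ≤ t` of the solution, with parameters `θ` and condition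
`z`, of `dx = F_θ(x, z, u) du + dN` run backwards from the state `y` at time `t`: the stochastic
flow of the equation. -/
def IsStochasticFlow (P : Measure Ω)
    (F : EuclideanSpace ℝ (Fin p) → EuclideanSpace ℝ (Fin d) → EuclideanSpace ℝ (Fin m) → ℝ →
      EuclideanSpace ℝ (Fin d))
    (N : ℝ → Ω → EuclideanSpace ℝ (Fin d)) (T : ℝ)
    (Φ : EuclideanSpace ℝ (Fin p) → EuclideanSpace ℝ (Fin m) → ℝ → EuclideanSpace ℝ (Fin d) →
      ℝ → Ω → EuclideanSpace ℝ (Fin d)) : Prop :=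
  ∀ᵐ ω ∂P, ∀ θ z, ∀ t ∈ Icc 0 T, ∀ y, Φ θ z t y t ω = y ∧
    IsPathSolution (fun x u => F θ x z u) (fun u => N u ω) 0 t (fun u => Φ θ z t y u ω)

/-! ### Adjoint states and adjoint SDEs

Adjoint states are row vectors, that is, elements of the dual space. -/

/-- The adjoint state `a_x(t) = ∂L(x_0) / ∂x_t`. -/
def adjointX (L : EuclideanSpace ℝ (Fin d) → ℝ)
    (Φ : EuclideanSpace ℝ (Fin p) → EuclideanSpace ℝ (Fin m) → ℝ → EuclideanSpace ℝ (Fin d) →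
      ℝ → Ω → EuclideanSpace ℝ (Fin d))
    (θ : EuclideanSpace ℝ (Fin p)) (z : EuclideanSpace ℝ (Fin m))
    (x : ℝ → Ω → EuclideanSpace ℝ (Fin d)) (t : ℝ) (ω : Ω) :
    EuclideanSpace ℝ (Fin d) →L[ℝ] ℝ :=
  fderiv ℝ (fun y => L (Φ θ z t y 0 ω)) (x t ω)

/-- The adjoint state `a_z(t)`: the derivative of `L(x_0)` with respect to the condition `z` that
drives the SDE between the times `t` and `0`, with `x_t` fixed. -/
def adjointZ (L : EuclideanSpace ℝ (Fin d) → ℝ)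
    (Φ : EuclideanSpace ℝ (Fin p) → EuclideanSpace ℝ (Fin m) → ℝ → EuclideanSpace ℝ (Fin d) →
      ℝ → Ω → EuclideanSpace ℝ (Fin d))
    (θ : EuclideanSpace ℝ (Fin p)) (z : EuclideanSpace ℝ (Fin m))
    (x : ℝ → Ω → EuclideanSpace ℝ (Fin d)) (t : ℝ) (ω : Ω) :
    EuclideanSpace ℝ (Fin m) →L[ℝ] ℝ :=
  fderiv ℝ (fun z' => L (Φ θ z' t (x t ω) 0 ω)) z

/-- The adjoint state `a_θ(t)`: the derivative of `L(x_0)` with respect to the parameters `θ` that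
drive the SDE between the times `t` and `0`, with `x_t` fixed. -/
def adjointTheta (L : EuclideanSpace ℝ (Fin d) → ℝ)
    (Φ : EuclideanSpace ℝ (Fin p) → EuclideanSpace ℝ (Fin m) → ℝ → EuclideanSpace ℝ (Fin d) →
      ℝ → Ω → EuclideanSpace ℝ (Fin d))
    (θ : EuclideanSpace ℝ (Fin p)) (z : EuclideanSpace ℝ (Fin m))
    (x : ℝ → Ω → EuclideanSpace ℝ (Fin d)) (t : ℝ) (ω : Ω) :
    EuclideanSpace ℝ (Fin p) →L[ℝ] ℝ :=
  fderiv ℝ (fun θ' => L (Φ θ' z t (x t ω) 0 ω)) θ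

/-- For a row vector `a` and the derivative `D = ∂G/∂h` of a matrix-valued function, the linear map
`dw ↦ - aᵀ (∂G/∂h) dw` with values in the row vectors. -/
def adjointDiffusionTerm {H : Type*} [NormedAddCommGroup H] [NormedSpace ℝ H]
    (a : EuclideanSpace ℝ (Fin d) →L[ℝ] ℝ)
    (D : H →L[ℝ] EuclideanSpace ℝ (Fin d) →L[ℝ] EuclideanSpace ℝ (Fin d)) :
    EuclideanSpace ℝ (Fin d) →L[ℝ] H →L[ℝ] ℝ :=
  -((ContinuousLinearMap.compL ℝ H (EuclideanSpace ℝ (Fin d)) ℝ a).comp D.flip)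

/-- `(a_x, a_z, a_θ)` solves on `[t, T]`, along the process `x`, the adjoint equations
`da_h = - a_xᵀ (∂F/∂h) dt - a_xᵀ (∂G/∂h) ∘ dw`, `h = x, z, θ`,
of the SDE `dx = F_θ(x, z, t) dt + G_θ(x, z, t) ∘ dw`. -/
structure SolvesAdjointSDE (P : Measure Ω) (w : ℝ → Ω → EuclideanSpace ℝ (Fin d))
    (F : EuclideanSpace ℝ (Fin p) → EuclideanSpace ℝ (Fin d) → EuclideanSpace ℝ (Fin m) → ℝ →
      EuclideanSpace ℝ (Fin d))
    (G : EuclideanSpace ℝ (Fin p) → EuclideanSpace ℝ (Fin d) → EuclideanSpace ℝ (Fin m) → ℝ →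
      EuclideanSpace ℝ (Fin d) →L[ℝ] EuclideanSpace ℝ (Fin d))
    (θ : EuclideanSpace ℝ (Fin p)) (z : EuclideanSpace ℝ (Fin m))
    (x : ℝ → Ω → EuclideanSpace ℝ (Fin d)) (t T : ℝ)
    (ax : ℝ → Ω → EuclideanSpace ℝ (Fin d) →L[ℝ] ℝ)
    (az : ℝ → Ω → EuclideanSpace ℝ (Fin m) →L[ℝ] ℝ)
    (aθ : ℝ → Ω → EuclideanSpace ℝ (Fin p) →L[ℝ] ℝ) : Prop where
  eq_x : SolvesStratonovich P w t T ax
    (fun u ω => -(ax u ω).comp (fderiv ℝ (fun y => F θ y z u) (x u ω)))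
    (fun u ω => adjointDiffusionTerm (ax u ω) (fderiv ℝ (fun y => G θ y z u) (x u ω)))
  eq_z : SolvesStratonovich P w t T az
    (fun u ω => -(ax u ω).comp (fderiv ℝ (fun z' => F θ (x u ω) z' u) z))
    (fun u ω => adjointDiffusionTerm (ax u ω) (fderiv ℝ (fun z' => G θ (x u ω) z' u) z))
  eq_theta : SolvesStratonovich P w t T aθ
    (fun u ω => -(ax u ω).comp (fderiv ℝ (fun θ' => F θ' (x u ω) z u) θ))
    (fun u ω => adjointDiffusionTerm (ax u ω) (fderiv ℝ (fun θ' => G θ' (x u ω) z u) θ))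

end Flow

end

end AdjointDiffusion

/-!
The diffusion matrix `g(t) I` depends on none of `x`, `z`, `θ`, so the noise terms of the adjoint
diffusion SDEs have the integrand zero. Their Stratonovich integrals vanish almost surely, at all
times at once because the paths are continuous, and the adjoint SDEs become linear integral equations
along each path (`solvesAdjointSDE_iff`). Existence, uniqueness and the exact formulas are then
pathwise statements. With `λ` the half log-SNR one has `g² / σ = - 2 σ λ'`, so that
`d(α a_x) = 2 α σ λ' a_x ∂ε/∂x dt` and `da_h = 2 σ λ' a_x ∂ε/∂h dt` for `h = z, θ`. The substitution
`l = λ_t` with `σ = α exp (-λ)` turns the integrals of these identities into the formulas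
(`IsNoiseSchedule.adjoint_state_formula`, `IsNoiseSchedule.adjoint_param_formula`).

The adjoint states also require the flow to be differentiable down to time `0`, where `g² / σ` may be
unbounded. It is still integrable there, being `2 α` times the derivative of the continuous increasing
function `σ / α`. Let `A` and `B` be the derivatives of the drift along the path `x` in the state and
in a parameter `h`, and let `Z` solve `dZ = - Z A dv` with `Z 0 = 1`; this solution exists by a
contraction argument (`exists_linear_integral_solution`). If `δ` is the difference between `x` and a
solution with a perturbed terminal state and parameter, driven by the same noise, then the noise
cancels in `δ`, and `Z δ` satisfies `d(Z δ) = Z (ΔF - A δ) dv`. Hence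
`δ 0 = Z s (δ s) - ∫₀ˢ Z (ΔF - A δ)`. Grönwall's inequality gives `δ = O(Δh)`, and dominated
convergence replaces `ΔF - A δ` by `B Δh` up to `o(Δh)` (`IsRegularFamily.hasFDerivAt_flow`).
Therefore the adjoint states are `a_x(s) = ℓ Z(s)` and `a_h(s) = - ℓ ∫₀ˢ Z B`, with `ℓ` the derivative
of the loss at `x_0` (`exists_adjointStates`), and the equation of `Z` is the adjoint equation.
-/

namespace AdjointDiffusion

open Filter Topology

/-! ### Linear integral equations with an integrable singularity -/

section Integral

variable {V : Type*} [NormedAddCommGroup V] {a b : ℝ}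

theorem intervalIntegrable_mono_Icc {g : ℝ → V} (hab : a ≤ b)
    (hg : IntervalIntegrable g volume a b) {c e : ℝ} (hc : c ∈ Icc a b) (he : e ∈ Icc a b) :
    IntervalIntegrable g volume c e := by
  refine hg.mono_set ?_
  rw [uIcc_of_le hab]
  exact uIcc_subset_Icc hc he

/-- An integrand which is continuous on the half-open interval and dominated by an integrable
function is integrable. -/
theorem intervalIntegrable_of_continuousOn_Ioc {g : ℝ → V} {κ : ℝ → ℝ} (hab : a ≤ b)
    (hg : ContinuousOn g (Ioc a b)) (hκ : IntervalIntegrable κ volume a b)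
    (hle : ∀ v ∈ Ioc a b, ‖g v‖ ≤ κ v) : IntervalIntegrable g volume a b := by
  rw [intervalIntegrable_iff_integrableOn_Ioc_of_le hab] at hκ ⊢
  refine hκ.mono' (hg.aestronglyMeasurable measurableSet_Ioc) ?_
  exact (ae_restrict_iff' measurableSet_Ioc).2 (Eventually.of_forall hle)

variable [NormedSpace ℝ V]

theorem continuousOn_primitive_Icc {g : ℝ → V} (hab : a ≤ b)
    (hg : IntervalIntegrable g volume a b) : ContinuousOn (fun s => ∫ v in a..s, g v) (Icc a b) := by
  have h := intervalIntegral.continuousOn_primitive_interval' hg left_mem_uIcc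
  rwa [uIcc_of_le hab] at h

theorem hasDerivAt_primitive_Ioo [CompleteSpace V] {g : ℝ → V}
    (hg : IntervalIntegrable g volume a b) (hc : ContinuousOn g (Ioo a b)) {s : ℝ}
    (hs : s ∈ Ioo a b) : HasDerivAt (fun s => ∫ v in a..s, g v) (g s) s := by
  have hab : a ≤ b := (hs.1.trans hs.2).le
  exact intervalIntegral.integral_hasDerivAt_right
    (intervalIntegrable_mono_Icc hab hg (left_mem_Icc.2 hab) (Ioo_subset_Icc_self hs))
    (hc.stronglyMeasurableAtFilter isOpen_Ioo s hs) (hc.continuousAt (isOpen_Ioo.mem_nhds hs))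

/-- Grönwall's inequality in integral form; the kernel `κ` may be singular at the end points. -/
theorem gronwall_integral_le {φ κ : ℝ → ℝ} {C : ℝ} (hab : a ≤ b) (hφ : ContinuousOn φ (Icc a b))
    (hκ : ContinuousOn κ (Ioo a b)) (hκi : IntervalIntegrable κ volume a b)
    (hκ0 : ∀ v ∈ Ioo a b, 0 ≤ κ v)
    (h : ∀ s ∈ Icc a b, φ s ≤ C + ∫ v in a..s, κ v * φ v) {s : ℝ} (hs : s ∈ Icc a b) :
    φ s ≤ C * Real.exp (∫ v in a..s, κ v) := by
  have hi : IntervalIntegrable (fun v => κ v * φ v) volume a b :=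
    hκi.mul_continuousOn (by rwa [uIcc_of_le hab])
  -- `(C + ∫ κ φ) exp (- ∫ κ)` has a nonpositive derivative
  set G : ℝ → ℝ := fun s => (C + ∫ v in a..s, κ v * φ v) * Real.exp (-∫ v in a..s, κ v) with hG
  have hGanti : AntitoneOn G (Icc a b) := by
    have hder : ∀ s ∈ Ioo a b, HasDerivAt G
        (κ s * φ s * Real.exp (-∫ v in a..s, κ v) +
          (C + ∫ v in a..s, κ v * φ v) * (Real.exp (-∫ v in a..s, κ v) * -κ s)) s := fun s hs =>
      ((hasDerivAt_primitive_Ioo hi (hκ.mul (hφ.mono Ioo_subset_Icc_self)) hs).const_add C).mul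
        (hasDerivAt_primitive_Ioo hκi hκ hs).neg.exp
    refine antitoneOn_of_deriv_nonpos (convex_Icc a b) ?_ ?_ ?_
    · exact (continuousOn_const.add (continuousOn_primitive_Icc hab hi)).mul
        (continuousOn_primitive_Icc hab hκi).neg.rexp
    · rw [interior_Icc]
      exact fun s hs => (hder s hs).differentiableAt.differentiableWithinAt
    · rw [interior_Icc]
      intro s hs
      rw [(hder s hs).deriv]
      have h1 := mul_nonneg (hκ0 s hs) (sub_nonneg.2 (h s (Ioo_subset_Icc_self hs)))
      have h2 := mul_nonneg h1 (Real.exp_pos (-∫ v in a..s, κ v)).le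
      nlinarith
  have h1 := hGanti (left_mem_Icc.2 hab) hs hs.1
  simp only [hG, intervalIntegral.integral_same, add_zero, neg_zero, Real.exp_zero, mul_one] at h1
  rw [Real.exp_neg, ← div_eq_mul_inv, div_le_iff₀ (Real.exp_pos _)] at h1
  exact (h s hs).trans h1

/-- Grönwall's inequality backwards in time. -/
theorem gronwall_integral_le_backward {φ κ : ℝ → ℝ} {C : ℝ} (hab : a ≤ b)
    (hφ : ContinuousOn φ (Icc a b)) (hκ : ContinuousOn κ (Ioo a b))
    (hκi : IntervalIntegrable κ volume a b) (hκ0 : ∀ v ∈ Ioo a b, 0 ≤ κ v)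
    (h : ∀ s ∈ Icc a b, φ s ≤ C + ∫ v in s..b, κ v * φ v) {s : ℝ} (hs : s ∈ Icc a b) :
    φ s ≤ C * Real.exp (∫ v in s..b, κ v) := by
  have hm : Continuous fun v : ℝ => a + b - v := by fun_prop
  have key := gronwall_integral_le (φ := fun v => φ (a + b - v)) (κ := fun v => κ (a + b - v))
    (C := C) hab (hφ.comp hm.continuousOn fun v hv => ⟨by linarith [hv.2], by linarith [hv.1]⟩)
    (hκ.comp hm.continuousOn fun v hv => ⟨by linarith [hv.2], by linarith [hv.1]⟩)
    (by simpa using (hκi.comp_sub_left (a + b)).symm)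
    (fun v hv => hκ0 _ ⟨by linarith [hv.2], by linarith [hv.1]⟩)
    (fun v hv => by
      have := h (a + b - v) ⟨by linarith [hv.2], by linarith [hv.1]⟩
      rwa [intervalIntegral.integral_comp_sub_left (fun u => κ u * φ u) (a + b),
        add_sub_cancel_left])
    (s := a + b - s) ⟨by linarith [hs.2], by linarith [hs.1]⟩
  rw [intervalIntegral.integral_comp_sub_left κ (a + b)] at key
  simpa using key

/-- A linear integral equation whose kernel is continuous on `(a, b]` and dominated by an integrable
function has a solution. In the norm `sup ‖exp (-2 ∫ κ) f‖` the Picard map is a contraction. -/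
theorem exists_linear_integral_solution [CompleteSpace V] {A : ℝ → V →L[ℝ] V} {κ : ℝ → ℝ}
    (hab : a ≤ b) (hA : ContinuousOn A (Ioc a b)) (hκ : ContinuousOn κ (Ioc a b))
    (hκi : IntervalIntegrable κ volume a b) (hle : ∀ v ∈ Ioc a b, ‖A v‖ ≤ κ v) (z₀ : V) :
    ∃ Z : ℝ → V, ContinuousOn Z (Icc a b) ∧
      ∀ s ∈ Icc a b, Z s = z₀ + ∫ v in a..s, A v (Z v) := by
  set K : ℝ → ℝ := fun s => ∫ v in a..s, κ v with hK
  have hKc : ContinuousOn K (Icc a b) := continuousOn_primitive_Icc hab hκi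
  have hsub : ∀ s ∈ Icc a b, Ioc a s ⊆ Ioc a b := fun s hs => Ioc_subset_Ioc_right hs.2
  -- integrability of the kernel applied to a continuous function
  have hint : ∀ f : ℝ → V, ContinuousOn f (Icc a b) →
      IntervalIntegrable (fun v => A v (f v)) volume a b := by
    intro f hf
    obtain ⟨M, hM⟩ := isCompact_Icc.exists_bound_of_continuousOn hf
    refine intervalIntegrable_of_continuousOn_Ioc hab (hA.clm_apply (hf.mono Ioc_subset_Icc_self))
      (hκi.mul_const M) fun v hv => ?_
    exact ((A v).le_opNorm _).trans (mul_le_mul (hle v hv) (hM v (Ioc_subset_Icc_self hv))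
      (norm_nonneg _) ((norm_nonneg _).trans (hle v hv)))
  -- the weight integrates explicitly
  have hexp : ∀ s ∈ Icc a b, ∫ v in a..s, κ v * Real.exp (2 * K v) =
      (Real.exp (2 * K s) - 1) / 2 := by
    intro s hs
    have hss : Icc a s ⊆ Icc a b := Icc_subset_Icc_right hs.2
    rw [intervalIntegral.integral_eq_sub_of_hasDerivAt_of_le hs.1
      (f := fun v => Real.exp (2 * K v) / 2)]
    · simp [hK]; ring
    · exact ((continuousOn_const.mul (hKc.mono hss)).rexp).div_const 2
    · intro v hv
      have hv' : v ∈ Ioo a b := ⟨hv.1, hv.2.trans_le hs.2⟩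
      have := (((hasDerivAt_primitive_Ioo hκi (hκ.mono Ioo_subset_Ioc_self) hv').const_mul
        2).exp).div_const 2
      refine this.congr_deriv ?_
      change _ = κ v * Real.exp (2 * ∫ u in a..v, κ u)
      ring
    · refine (intervalIntegrable_mono_Icc hab hκi (left_mem_Icc.2 hab) hs).mul_continuousOn ?_
      rw [uIcc_of_le hs.1]
      exact (continuousOn_const.mul (hKc.mono hss)).rexp
  have hext : ∀ f : C(Icc a b, V),
      ContinuousOn (fun v => Real.exp (2 * K v) • IccExtend hab f v) (Icc a b) := fun f =>
    (continuousOn_const.mul hKc).rexp.smul (f.continuous.Icc_extend' (h := hab)).continuousOn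
  let W : C(Icc a b, V) → C(Icc a b, V) := fun f =>
    ⟨fun s => Real.exp (-(2 * K s)) •
      (z₀ + ∫ v in a..(s : ℝ), A v (Real.exp (2 * K v) • IccExtend hab f v)), by
      have : ContinuousOn (fun s : ℝ => Real.exp (-(2 * K s)) •
          (z₀ + ∫ v in a..s, A v (Real.exp (2 * K v) • IccExtend hab f v))) (Icc a b) :=
        (continuousOn_const.mul hKc).neg.rexp.smul
          (continuousOn_const.add (continuousOn_primitive_Icc hab (hint _ (hext f))))
      exact continuousOn_iff_continuous_domRestrict.1 this⟩
  have hW : ContractingWith (1 / 2) W := by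
    refine ⟨by rw [← NNReal.coe_lt_coe]; norm_num, LipschitzWith.of_dist_le_mul fun f g => ?_⟩
    refine (ContinuousMap.dist_le (by positivity)).2 fun s => ?_
    have hs := s.2
    have hi := fun f => intervalIntegrable_mono_Icc hab (hint _ (hext f)) (left_mem_Icc.2 hab) hs
    have hbd : ‖∫ v in a..(s : ℝ), (A v (Real.exp (2 * K v) • IccExtend hab f v)
        - A v (Real.exp (2 * K v) • IccExtend hab g v))‖ ≤
        ∫ v in a..(s : ℝ), (κ v * Real.exp (2 * K v)) * dist f g := by
      refine intervalIntegral.norm_integral_le_of_norm_le hs.1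
        (Eventually.of_forall fun v hv => ?_) ?_
      · rw [← map_sub, ← smul_sub]
        refine ((A v).le_opNorm _).trans ?_
        rw [norm_smul, Real.norm_of_nonneg (Real.exp_pos _).le, mul_assoc]
        refine mul_le_mul (hle v (hsub s hs hv)) ?_ (by positivity)
          ((norm_nonneg _).trans (hle v (hsub s hs hv)))
        refine mul_le_mul_of_nonneg_left ?_ (Real.exp_pos _).le
        rw [← dist_eq_norm]
        exact ContinuousMap.dist_apply_le_dist _
      · refine IntervalIntegrable.mul_const ?_ _
        refine (intervalIntegrable_mono_Icc hab hκi (left_mem_Icc.2 hab) hs).mul_continuousOn ?_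
        rw [uIcc_of_le hs.1]
        exact (continuousOn_const.mul (hKc.mono (Icc_subset_Icc_right hs.2))).rexp
    rw [intervalIntegral.integral_mul_const, hexp s hs] at hbd
    change dist (Real.exp (-(2 * K s)) • (z₀ + _)) (Real.exp (-(2 * K s)) • (z₀ + _)) ≤ _
    rw [dist_eq_norm, ← smul_sub, add_sub_add_left_eq_sub, norm_smul,
      ← intervalIntegral.integral_sub (hi f) (hi g), Real.norm_of_nonneg (Real.exp_pos _).le]
    refine (mul_le_mul_of_nonneg_left hbd (Real.exp_pos _).le).trans ?_
    have h1 : Real.exp (-(2 * K s)) * Real.exp (2 * K s) = 1 := by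
      rw [← Real.exp_add]; simp
    have h2 : Real.exp (-(2 * K s)) * ((Real.exp (2 * K s) - 1) / 2 * dist f g) =
        (1 - Real.exp (-(2 * K s))) / 2 * dist f g := by
      linear_combination (dist f g / 2) * h1
    rw [h2]
    refine mul_le_mul_of_nonneg_right ?_ dist_nonneg
    push_cast
    linarith [Real.exp_pos (-(2 * K s))]
  set F := hW.fixedPoint W with hF
  have hfix : W F = F := hW.fixedPoint_isFixedPt
  refine ⟨fun v => Real.exp (2 * K v) • IccExtend hab F v, hext F, fun s hs => ?_⟩
  have h1 : F ⟨s, hs⟩ = Real.exp (-(2 * K s)) •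
      (z₀ + ∫ v in a..s, A v (Real.exp (2 * K v) • IccExtend hab F v)) := by
    conv_lhs => rw [← hfix]
    rfl
  have h2 : IccExtend hab F s = F ⟨s, hs⟩ := IccExtend_of_mem hab F hs
  beta_reduce
  rw [h2, h1, smul_smul, ← Real.exp_add]
  simp

end Integral

/-! ### Differentiability of the flow in the initial state and in parameters -/

section FlowDerivative

variable {d : ℕ} {H : Type*} [NormedAddCommGroup H] [NormedSpace ℝ H]

/-- A solution on `[s, T]` is also a solution on `[s, t]` for `t ≤ T`. -/
theorem IsPathSolution.restrict {F : EuclideanSpace ℝ (Fin d) → ℝ → EuclideanSpace ℝ (Fin d)}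
    {N x : ℝ → EuclideanSpace ℝ (Fin d)} {s t T : ℝ} (hx : IsPathSolution F N s T x)
    (ht : t ∈ Icc s T) : IsPathSolution F N s t x := by
  refine ⟨hx.1.mono (Icc_subset_Icc_right ht.2), fun u hu => ?_⟩
  obtain ⟨hiu, hu'⟩ := hx.2 u ⟨hu.1, hu.2.trans ht.2⟩
  obtain ⟨hit, ht'⟩ := hx.2 t ht
  refine ⟨hiu.trans hit.symm, ?_⟩
  rw [hu', ht', ← intervalIntegral.integral_add_adjacent_intervals (hiu.trans hit.symm) hit]
  abel

/-- The difference of two solutions driven by the same noise is free of noise. -/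
theorem IsPathSolution.sub_eq {F G : EuclideanSpace ℝ (Fin d) → ℝ → EuclideanSpace ℝ (Fin d)}
    {N x y : ℝ → EuclideanSpace ℝ (Fin d)} {s : ℝ} (hx : IsPathSolution F N 0 s x)
    (hy : IsPathSolution G N 0 s y) {u : ℝ} (hu : u ∈ Icc 0 s) :
    y u - x u = (y s - x s) - ∫ v in u..s, (G (y v) v - F (x v) v) := by
  rw [intervalIntegral.integral_sub (hy.2 u hu).1 (hx.2 u hu).1, (hy.2 u hu).2, (hx.2 u hu).2]
  abel

/-- Regularity of a family `F h` of time-dependent vector fields near the parameter `h₀`, along the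
path `x`. The function `κ`, which may be singular at time `0`, dominates the Lipschitz constants in
the state and in the parameter; `A` and `B` are the partial derivatives along `x`. -/
structure IsRegularFamily (T : ℝ)
    (F : H → EuclideanSpace ℝ (Fin d) → ℝ → EuclideanSpace ℝ (Fin d)) (κ : ℝ → ℝ) (h₀ : H)
    (x : ℝ → EuclideanSpace ℝ (Fin d))
    (A : ℝ → EuclideanSpace ℝ (Fin d) →L[ℝ] EuclideanSpace ℝ (Fin d))
    (B : ℝ → H →L[ℝ] EuclideanSpace ℝ (Fin d)) : Prop where
  continuousOn_bound : ContinuousOn κ (Ioc 0 T)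
  integrable_bound : IntervalIntegrable κ volume 0 T
  bound_nonneg : ∀ v ∈ Ioc 0 T, 0 ≤ κ v
  continuousOn_field : ∀ h, ContinuousOn
    (fun q : EuclideanSpace ℝ (Fin d) × ℝ => F h q.1 q.2) (univ ×ˢ Ioc 0 T)
  hasFDerivAt : ∀ v ∈ Ioc 0 T, HasFDerivAt
    (fun q : H × EuclideanSpace ℝ (Fin d) => F q.1 q.2 v) ((B v).coprod (A v)) (h₀, x v)
  continuousOn_A : ContinuousOn A (Ioc 0 T)
  continuousOn_B : ContinuousOn B (Ioc 0 T)
  lipschitz_state : ∀ᶠ h in 𝓝 h₀, ∀ v ∈ Ioc 0 T, ∀ y y',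
    ‖F h y v - F h y' v‖ ≤ κ v * ‖y - y'‖
  lipschitz_param : ∀ᶠ h in 𝓝 h₀, ∀ v ∈ Ioc 0 T,
    ‖F h (x v) v - F h₀ (x v) v‖ ≤ κ v * ‖h - h₀‖

namespace IsRegularFamily

variable {T : ℝ} {F : H → EuclideanSpace ℝ (Fin d) → ℝ → EuclideanSpace ℝ (Fin d)} {κ : ℝ → ℝ}
  {h₀ : H} {x : ℝ → EuclideanSpace ℝ (Fin d)}
  {A : ℝ → EuclideanSpace ℝ (Fin d) →L[ℝ] EuclideanSpace ℝ (Fin d)}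
  {B : ℝ → H →L[ℝ] EuclideanSpace ℝ (Fin d)}

theorem norm_A_le (hF : IsRegularFamily T F κ h₀ x A B) {v : ℝ} (hv : v ∈ Ioc 0 T) :
    ‖A v‖ ≤ κ v := by
  have h1 : HasFDerivAt (fun y => F h₀ y v) (A v) (x v) := by
    have := (hF.hasFDerivAt v hv).comp (x v) ((hasFDerivAt_prodMk_right h₀ (x v)))
    simpa [ContinuousLinearMap.coprod_comp_inr, Function.comp_def] using this
  exact h1.le_of_lip' (hF.bound_nonneg v hv)
    (Eventually.of_forall fun y => hF.lipschitz_state.self_of_nhds v hv y (x v))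

theorem norm_B_le (hF : IsRegularFamily T F κ h₀ x A B) {v : ℝ} (hv : v ∈ Ioc 0 T) :
    ‖B v‖ ≤ κ v := by
  have h1 : HasFDerivAt (fun h => F h (x v) v) (B v) h₀ := by
    have h2 : HasFDerivAt (fun h : H => (h, x v))
        (ContinuousLinearMap.inl ℝ H (EuclideanSpace ℝ (Fin d))) h₀ := hasFDerivAt_prodMk_left _ _
    have := (hF.hasFDerivAt v hv).comp h₀ h2
    simpa [ContinuousLinearMap.coprod_comp_inl, Function.comp_def] using this
  exact h1.le_of_lip' (hF.bound_nonneg v hv) (hF.lipschitz_param.mono fun h hh => hh v hv)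

variable {N y : ℝ → EuclideanSpace ℝ (Fin d)} {s : ℝ} {h : H}

theorem continuousOn_comp (hF : IsRegularFamily T F κ h₀ x A B) (hsT : s ≤ T)
    (hy : ContinuousOn y (Icc 0 s)) : ContinuousOn (fun v => F h (y v) v) (Ioc 0 s) :=
  (hF.continuousOn_field h).comp ((hy.mono Ioc_subset_Icc_self).prodMk continuousOn_id)
    fun _ hv => ⟨mem_univ _, hv.1, hv.2.trans hsT⟩

/-- Solutions depend in a Lipschitz way on the terminal state and on the parameter. -/
theorem norm_solution_sub_le (hF : IsRegularFamily T F κ h₀ x A B) (hs : s ∈ Icc 0 T)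
    (hx : IsPathSolution (F h₀) N 0 s x) (hy : IsPathSolution (F h) N 0 s y)
    (h1 : ∀ v ∈ Ioc 0 T, ∀ y y', ‖F h y v - F h y' v‖ ≤ κ v * ‖y - y'‖)
    (h2 : ∀ v ∈ Ioc 0 T, ‖F h (x v) v - F h₀ (x v) v‖ ≤ κ v * ‖h - h₀‖)
    {u : ℝ} (hu : u ∈ Icc 0 s) :
    ‖y u - x u‖ ≤ (‖y s - x s‖ + (∫ v in (0 : ℝ)..s, κ v) * ‖h - h₀‖) *
      Real.exp (∫ v in (0 : ℝ)..s, κ v) := by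
  have hsub : Ioc 0 s ⊆ Ioc 0 T := Ioc_subset_Ioc_right hs.2
  have hκi : IntervalIntegrable κ volume 0 s :=
    intervalIntegrable_mono_Icc (hs.1.trans hs.2) hF.integrable_bound
      (left_mem_Icc.2 (hs.1.trans hs.2)) hs
  have hδ : ContinuousOn (fun v => ‖y v - x v‖) (Icc 0 s) := (hy.1.sub hx.1).norm
  have hκδ : IntervalIntegrable (fun v => κ v * ‖y v - x v‖) volume 0 s :=
    hκi.mul_continuousOn (by rwa [uIcc_of_le hs.1])
  have hs0 : s ∈ Icc 0 s := right_mem_Icc.2 hs.1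
  have hmono : ∀ u ∈ Icc 0 s, ∫ v in u..s, κ v ≤ ∫ v in (0 : ℝ)..s, κ v := fun u hu => by
    rw [← intervalIntegral.integral_add_adjacent_intervals
      (intervalIntegrable_mono_Icc hs.1 hκi (left_mem_Icc.2 hs.1) hu)
      (intervalIntegrable_mono_Icc hs.1 hκi hu hs0)]
    refine le_add_of_nonneg_left ?_
    rw [intervalIntegral.integral_of_le hu.1]
    exact setIntegral_nonneg measurableSet_Ioc fun v hv =>
      hF.bound_nonneg v (hsub ⟨hv.1, hv.2.trans hu.2⟩)
  have h0 : 0 ≤ ∫ v in (0 : ℝ)..s, κ v := by simpa using hmono s hs0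
  have key := gronwall_integral_le_backward (φ := fun v => ‖y v - x v‖) (κ := κ)
    (C := ‖y s - x s‖ + (∫ v in (0 : ℝ)..s, κ v) * ‖h - h₀‖) hs.1 hδ
    (hF.continuousOn_bound.mono (Ioo_subset_Ioc_self.trans hsub)) hκi
    (fun v hv => hF.bound_nonneg v (hsub (Ioo_subset_Ioc_self hv))) ?_ hu
  · refine key.trans ?_
    gcongr
    exact hmono u hu
  intro u hu
  have hi1 := intervalIntegrable_mono_Icc hs.1 hκδ hu hs0
  have hi2 := (intervalIntegrable_mono_Icc hs.1 hκi hu hs0).mul_const ‖h - h₀‖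
  have hle : ‖∫ v in u..s, (F h (y v) v - F h₀ (x v) v)‖ ≤
      ∫ v in u..s, (κ v * ‖y v - x v‖ + κ v * ‖h - h₀‖) := by
    refine intervalIntegral.norm_integral_le_of_norm_le hu.2 (Eventually.of_forall fun v hv => ?_)
      (hi1.add hi2)
    have hv' : v ∈ Ioc 0 T := hsub ⟨hu.1.trans_lt hv.1, hv.2⟩
    calc ‖F h (y v) v - F h₀ (x v) v‖
        = ‖(F h (y v) v - F h (x v) v) + (F h (x v) v - F h₀ (x v) v)‖ := by
          rw [sub_add_sub_cancel]
      _ ≤ _ := (norm_add_le _ _).trans (add_le_add (h1 v hv' _ _) (h2 v hv'))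
  rw [intervalIntegral.integral_add hi1 hi2, intervalIntegral.integral_mul_const] at hle
  beta_reduce
  rw [hx.sub_eq hy hu]
  have := mul_le_mul_of_nonneg_right (hmono u hu) (norm_nonneg (h - h₀))
  linarith [norm_sub_le (y s - x s) (∫ v in u..s, (F h (y v) v - F h₀ (x v) v))]

/-- Pairing the difference of two solutions with a solution `Z` of the adjoint equation
`dZ = - Z A dv` removes the linear part of the evolution. -/
theorem sub_zero_eq (hF : IsRegularFamily T F κ h₀ x A B) (hs : s ∈ Icc 0 T)
    (hx : IsPathSolution (F h₀) N 0 s x) (hy : IsPathSolution (F h) N 0 s y)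
    {Z : ℝ → EuclideanSpace ℝ (Fin d) →L[ℝ] EuclideanSpace ℝ (Fin d)}
    (hZc : ContinuousOn Z (Icc 0 T))
    (hZ : ∀ u ∈ Icc 0 T, Z u = ContinuousLinearMap.id ℝ _ + ∫ v in (0 : ℝ)..u, -(Z v).comp (A v)) :
    IntervalIntegrable (fun v => Z v (F h (y v) v - F h₀ (x v) v - A v (y v - x v))) volume 0 s ∧
    y 0 - x 0 = Z s (y s - x s) -
      ∫ v in (0 : ℝ)..s, Z v (F h (y v) v - F h₀ (x v) v - A v (y v - x v)) := by
  have h0T : 0 ≤ T := hs.1.trans hs.2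
  have hsub : Ioc 0 s ⊆ Ioc 0 T := Ioc_subset_Ioc_right hs.2
  have hIsub : Icc 0 s ⊆ Icc 0 T := Icc_subset_Icc_right hs.2
  have h00 : (0 : ℝ) ∈ Icc 0 s := left_mem_Icc.2 hs.1
  have hs0 : s ∈ Icc 0 s := right_mem_Icc.2 hs.1
  have hδc : ContinuousOn (fun v => y v - x v) (Icc 0 s) := hy.1.sub hx.1
  obtain ⟨M, hM⟩ := isCompact_Icc.exists_bound_of_continuousOn hδc
  obtain ⟨M', hM'⟩ := isCompact_Icc.exists_bound_of_continuousOn (hZc.mono hIsub)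
  have hκi : IntervalIntegrable κ volume 0 s :=
    intervalIntegrable_mono_Icc h0T hF.integrable_bound (left_mem_Icc.2 h0T) hs
  have hGi : IntervalIntegrable (fun v => F h (y v) v - F h₀ (x v) v) volume 0 s :=
    (hy.2 0 h00).1.sub (hx.2 0 h00).1
  have hGc : ContinuousOn (fun v => F h (y v) v - F h₀ (x v) v) (Ioc 0 s) :=
    (hF.continuousOn_comp hs.2 hy.1).sub (hF.continuousOn_comp hs.2 hx.1)
  have hAc : ContinuousOn (fun v => A v (y v - x v)) (Ioc 0 s) :=
    (hF.continuousOn_A.mono hsub).clm_apply (hδc.mono Ioc_subset_Icc_self)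
  have hAi : IntervalIntegrable (fun v => A v (y v - x v)) volume 0 s :=
    intervalIntegrable_of_continuousOn_Ioc hs.1 hAc (hκi.mul_const M) fun v hv =>
      ((A v).le_opNorm _).trans (mul_le_mul (hF.norm_A_le (hsub hv)) (hM v (Ioc_subset_Icc_self hv))
        (norm_nonneg _) (hF.bound_nonneg v (hsub hv)))
  have hZi : IntervalIntegrable (fun v => -(Z v).comp (A v)) volume 0 s := by
    refine intervalIntegrable_of_continuousOn_Ioc hs.1
      (((hZc.mono hIsub).mono Ioc_subset_Icc_self).clm_comp (hF.continuousOn_A.mono hsub)).neg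
      (hκi.const_mul M') fun v hv => ?_
    rw [norm_neg]
    exact ((Z v).opNorm_comp_le _).trans (mul_le_mul (hM' v (Ioc_subset_Icc_self hv))
      (hF.norm_A_le (hsub hv)) (norm_nonneg _)
      ((norm_nonneg _).trans (hM' v (Ioc_subset_Icc_self hv))))
  have hint : IntervalIntegrable
      (fun v => Z v (F h (y v) v - F h₀ (x v) v - A v (y v - x v))) volume 0 s := by
    refine intervalIntegrable_of_continuousOn_Ioc hs.1
      (((hZc.mono hIsub).mono Ioc_subset_Icc_self).clm_apply (hGc.sub hAc))
      ((hGi.sub hAi).norm.const_mul M') fun v hv => ?_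
    exact ((Z v).le_opNorm _).trans (mul_le_mul_of_nonneg_right
      (hM' v (Ioc_subset_Icc_self hv)) (norm_nonneg _))
  refine ⟨hint, ?_⟩
  rw [intervalIntegral.integral_eq_sub_of_hasDerivAt_of_le (f := fun v => Z v (y v - x v)) hs.1
    ((hZc.mono hIsub).clm_apply hδc) ?_ hint]
  · have hZ0 : Z 0 = ContinuousLinearMap.id ℝ _ := by simpa using hZ 0 (left_mem_Icc.2 h0T)
    simp [hZ0]
  intro v hv
  have hIoo : Ioo 0 s ∈ 𝓝 v := isOpen_Ioo.mem_nhds hv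
  have hZd : HasDerivAt Z (-(Z v).comp (A v)) v := by
    refine ((hasDerivAt_primitive_Ioo hZi ?_ hv).const_add
      (ContinuousLinearMap.id ℝ (EuclideanSpace ℝ (Fin d)))).congr_of_eventuallyEq ?_
    · exact (((hZc.mono hIsub).mono Ioo_subset_Icc_self).clm_comp
        (hF.continuousOn_A.mono (Ioo_subset_Ioc_self.trans hsub))).neg
    · filter_upwards [hIoo] with u hu
      exact hZ u (hIsub (Ioo_subset_Icc_self hu))
  have hδd : HasDerivAt (fun v => y v - x v) (F h (y v) v - F h₀ (x v) v) v := by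
    refine ((hasDerivAt_primitive_Ioo hGi (hGc.mono Ioo_subset_Ioc_self) hv).const_add
      (y 0 - x 0)).congr_of_eventuallyEq ?_
    filter_upwards [hIoo] with u hu
    have hu' := Ioo_subset_Icc_self hu
    rw [hx.sub_eq hy hu', hx.sub_eq hy h00,
      ← intervalIntegral.integral_add_adjacent_intervals
        (intervalIntegrable_mono_Icc hs.1 hGi h00 hu') (intervalIntegrable_mono_Icc hs.1 hGi hu' hs0)]
    abel
  refine (hZd.clm_apply hδd).congr_deriv ?_
  simp [sub_eq_add_neg, add_comm]

/-- The derivative at time `0` of the solutions that start at time `s` from `x s + S (h - h₀)` and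
evolve with the parameter `h`, expressed by the solution `Z` of the adjoint equation. -/
theorem hasFDerivAt_flow (hF : IsRegularFamily T F κ h₀ x A B) (hs : s ∈ Icc 0 T)
    (hx : IsPathSolution (F h₀) N 0 s x) {Y : H → ℝ → EuclideanSpace ℝ (Fin d)}
    (hY : ∀ h, IsPathSolution (F h) N 0 s (Y h)) (S : H →L[ℝ] EuclideanSpace ℝ (Fin d))
    (hYs : ∀ h, Y h s = x s + S (h - h₀))
    {Z : ℝ → EuclideanSpace ℝ (Fin d) →L[ℝ] EuclideanSpace ℝ (Fin d)}
    (hZc : ContinuousOn Z (Icc 0 T))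
    (hZ : ∀ u ∈ Icc 0 T, Z u = ContinuousLinearMap.id ℝ _ + ∫ v in (0 : ℝ)..u, -(Z v).comp (A v)) :
    Y h₀ 0 = x 0 ∧ HasFDerivAt (fun h => Y h 0)
      ((Z s).comp S - ∫ v in (0 : ℝ)..s, (Z v).comp (B v)) h₀ := by
  have h0T : 0 ≤ T := hs.1.trans hs.2
  have hsub : Ioc 0 s ⊆ Ioc 0 T := Ioc_subset_Ioc_right hs.2
  have hIsub : Icc 0 s ⊆ Icc 0 T := Icc_subset_Icc_right hs.2
  have hκi : IntervalIntegrable κ volume 0 s :=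
    intervalIntegrable_mono_Icc h0T hF.integrable_bound (left_mem_Icc.2 h0T) hs
  obtain ⟨M, hM⟩ := isCompact_Icc.exists_bound_of_continuousOn (hZc.mono hIsub)
  -- the Lipschitz constant of `h ↦ Y h u`
  set C : ℝ := (‖S‖ + ∫ v in (0 : ℝ)..s, κ v) * Real.exp (∫ v in (0 : ℝ)..s, κ v) with hC
  have hlip : ∀ᶠ h in 𝓝 h₀, ∀ u ∈ Icc 0 s, ‖Y h u - x u‖ ≤ C * ‖h - h₀‖ := by
    filter_upwards [hF.lipschitz_state, hF.lipschitz_param] with h h1 h2 u hu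
    refine (hF.norm_solution_sub_le hs hx (hY h) h1 h2 hu).trans ?_
    rw [hYs, add_sub_cancel_left, hC, mul_right_comm, add_mul ‖S‖]
    exact mul_le_mul_of_nonneg_right (add_le_add_left (S.le_opNorm _) _) (Real.exp_pos _).le
  have hY0 : ∀ u ∈ Icc 0 s, Y h₀ u = x u := fun u hu => by
    have := hlip.self_of_nhds u hu
    rw [sub_self, norm_zero, mul_zero] at this
    exact sub_eq_zero.1 (norm_le_zero_iff.1 this)
  have hBi : IntervalIntegrable (fun v => (Z v).comp (B v)) volume 0 s := by
    refine intervalIntegrable_of_continuousOn_Ioc hs.1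
      (((hZc.mono hIsub).mono Ioc_subset_Icc_self).clm_comp (hF.continuousOn_B.mono hsub))
      (hκi.const_mul M) fun v hv => ?_
    exact ((Z v).opNorm_comp_le _).trans (mul_le_mul (hM v (Ioc_subset_Icc_self hv))
      (hF.norm_B_le (hsub hv)) (norm_nonneg _)
      ((norm_nonneg _).trans (hM v (Ioc_subset_Icc_self hv))))
  have h00 : (0 : ℝ) ∈ Icc 0 s := left_mem_Icc.2 hs.1
  refine ⟨hY0 0 h00, ?_⟩
  -- the remainder of the first order expansion of the vector field
  set R : H → ℝ → EuclideanSpace ℝ (Fin d) := fun h v =>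
    F h (Y h v) v - F h₀ (x v) v - A v (Y h v - x v) - B v (h - h₀) with hR
  have hrem : ∀ h, Y h 0 - Y h₀ 0 - ((Z s).comp S - ∫ v in (0 : ℝ)..s, (Z v).comp (B v)) (h - h₀) =
      -∫ v in (0 : ℝ)..s, Z v (R h v) := by
    intro h
    obtain ⟨hi, he⟩ := hF.sub_zero_eq hs hx (hY h) hZc hZ
    have hBi' : IntervalIntegrable (fun v => Z v (B v (h - h₀))) volume 0 s := by
      have := hBi.norm.mul_const ‖h - h₀‖
      refine intervalIntegrable_of_continuousOn_Ioc hs.1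
        (((hZc.mono hIsub).mono Ioc_subset_Icc_self).clm_apply
          ((hF.continuousOn_B.mono hsub).clm_apply continuousOn_const)) this fun v _ => ?_
      exact ((Z v).comp (B v)).le_opNorm _
    have h1 : ∫ v in (0 : ℝ)..s, Z v (R h v) =
        (∫ v in (0 : ℝ)..s, Z v (F h (Y h v) v - F h₀ (x v) v - A v (Y h v - x v))) -
          ∫ v in (0 : ℝ)..s, Z v (B v (h - h₀)) := by
      rw [← intervalIntegral.integral_sub hi hBi']
      simp only [hR, map_sub]
    have h2 : (∫ v in (0 : ℝ)..s, (Z v).comp (B v)) (h - h₀) =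
        ∫ v in (0 : ℝ)..s, Z v (B v (h - h₀)) := by
      rw [ContinuousLinearMap.intervalIntegral_apply hBi]
      rfl
    rw [hY0 0 h00, he, hYs, add_sub_cancel_left, h1, sub_apply, h2]
    simp only [ContinuousLinearMap.comp_apply]
    abel
  rw [hasFDerivAt_iff_tendsto]
  have hlim : Tendsto (fun h => ∫ v in (0 : ℝ)..s, ‖h - h₀‖⁻¹ • Z v (R h v)) (𝓝 h₀)
      (𝓝 (∫ _ in (0 : ℝ)..s, (0 : EuclideanSpace ℝ (Fin d)))) := by
    refine intervalIntegral.tendsto_integral_filter_of_dominated_convergence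
      (fun v => M * (κ v * (2 * C + 2))) ?_ ?_ ?_ ?_
    · refine Eventually.of_forall fun h => ?_
      rw [uIoc_of_le hs.1]
      suffices hc : ContinuousOn (fun v => Z v (R h v)) (Ioc 0 s) from
        (hc.const_smul ‖h - h₀‖⁻¹).aestronglyMeasurable measurableSet_Ioc
      refine ((hZc.mono hIsub).mono Ioc_subset_Icc_self).clm_apply ?_
      exact (((hF.continuousOn_comp hs.2 (hY h).1).sub (hF.continuousOn_comp hs.2 hx.1)).sub
        ((hF.continuousOn_A.mono hsub).clm_apply
          (((hY h).1.sub hx.1).mono Ioc_subset_Icc_self))).sub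
        ((hF.continuousOn_B.mono hsub).clm_apply continuousOn_const)
    · filter_upwards [hlip, hF.lipschitz_state, hF.lipschitz_param] with h h1 h2 h3
      refine Eventually.of_forall fun v hv => ?_
      rw [uIoc_of_le hs.1] at hv
      have hv' := hsub hv
      have hκ0 := hF.bound_nonneg v hv'
      have hδ := mul_le_mul_of_nonneg_left (h1 v (Ioc_subset_Icc_self hv)) hκ0
      have hRle : ‖R h v‖ ≤ κ v * (2 * C + 2) * ‖h - h₀‖ := by
        have e : R h v = (F h (Y h v) v - F h (x v) v) + (F h (x v) v - F h₀ (x v) v)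
            - A v (Y h v - x v) - B v (h - h₀) := by
          rw [sub_add_sub_cancel]
        have n1 := norm_sub_le ((F h (Y h v) v - F h (x v) v) + (F h (x v) v - F h₀ (x v) v)
            - A v (Y h v - x v)) (B v (h - h₀))
        have n2 := norm_sub_le ((F h (Y h v) v - F h (x v) v) + (F h (x v) v - F h₀ (x v) v))
            (A v (Y h v - x v))
        have n3 := norm_add_le (F h (Y h v) v - F h (x v) v) (F h (x v) v - F h₀ (x v) v)
        have n4 := (A v).le_of_opNorm_le (hF.norm_A_le hv') (Y h v - x v)
        have n5 := (B v).le_of_opNorm_le (hF.norm_B_le hv') (h - h₀)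
        have n6 := h2 v hv' (Y h v) (x v)
        have n7 := h3 v hv'
        rw [e]
        linarith
      rw [norm_smul, norm_inv, norm_norm]
      have hM0 : ‖Z v‖ ≤ M := hM v (Ioc_subset_Icc_self hv)
      have hZR : ‖Z v (R h v)‖ ≤ M * (κ v * (2 * C + 2)) * ‖h - h₀‖ :=
        ((Z v).le_of_opNorm_le hM0 _).trans (by
          rw [mul_assoc M]
          exact mul_le_mul_of_nonneg_left hRle ((norm_nonneg _).trans hM0))
      rcases eq_or_ne h h₀ with rfl | hne
      · have e0 : R h v = 0 := by
          simp [hR, hY0 v (Ioc_subset_Icc_self hv)]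
        have hC0 : 0 ≤ C := by
          have : 0 ≤ ∫ v in (0 : ℝ)..s, κ v := by
            rw [intervalIntegral.integral_of_le hs.1]
            exact setIntegral_nonneg measurableSet_Ioc fun v hv => hF.bound_nonneg v (hsub hv)
          positivity
        have hM00 := (norm_nonneg _).trans hM0
        rw [e0, map_zero, norm_zero, mul_zero]
        positivity
      · have hpos : 0 < ‖h - h₀‖ := norm_pos_iff.2 (sub_ne_zero.2 hne)
        rw [inv_mul_le_iff₀ hpos]
        linarith
    · exact (hκi.mul_const _).const_mul M
    · refine Eventually.of_forall fun v hv => ?_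
      rw [uIoc_of_le hs.1] at hv
      have hlipv : ∀ᶠ h in 𝓝 h₀, ‖Y h v - x v‖ ≤ C * ‖h - h₀‖ :=
        hlip.mono fun h hh => hh v (Ioc_subset_Icc_self hv)
      have hO : (fun h => Y h v - x v) =O[𝓝 h₀] fun h => h - h₀ :=
        Asymptotics.IsBigO.of_bound C hlipv
      have ht : Tendsto (fun h => (h, Y h v)) (𝓝 h₀) (𝓝 (h₀, x v)) := by
        refine tendsto_id.prodMk_nhds ?_
        rw [tendsto_iff_norm_sub_tendsto_zero]
        refine squeeze_zero' (Eventually.of_forall fun _ => norm_nonneg _) hlipv ?_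
        have : Tendsto (fun h => C * ‖h - h₀‖) (𝓝 h₀) (𝓝 (C * ‖h₀ - h₀‖)) := by
          apply Continuous.tendsto; fun_prop
        simpa using this
      have ho := (hasFDerivAt_iff_isLittleO.1 (hF.hasFDerivAt v (hsub hv))).comp_tendsto ht
      have hRo : (fun h => R h v) =o[𝓝 h₀] fun h => h - h₀ := by
        refine Asymptotics.IsLittleO.congr_left (ho.trans_isBigO
          ((Asymptotics.isBigO_refl _ _).prod_left hO)) fun h => ?_
        simp only [Function.comp_apply, hR, Prod.mk_sub_mk, ContinuousLinearMap.coprod_apply]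
        abel
      have hZo : (fun h => Z v (R h v)) =o[𝓝 h₀] fun h => h - h₀ :=
        ((Z v).isBigO_comp _ _).trans_isLittleO hRo
      have := hZo.norm_right.tendsto_inv_smul_nhds_zero
      exact this
  rw [intervalIntegral.integral_zero] at hlim
  refine (tendsto_zero_iff_norm_tendsto_zero.1 hlim).congr fun h => ?_
  rw [hrem, norm_neg, intervalIntegral.integral_smul, norm_smul, norm_inv, norm_norm]

end IsRegularFamily

end FlowDerivative

/-! ### The coefficients of the diffusion SDE -/

namespace IsNoiseSchedule

variable {T : ℝ} {α σ : ℝ → ℝ}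

theorem Ioc_eventuallyEq_Icc {t : ℝ} (ht : t ∈ Ioc 0 T) : Ioc 0 T =ᶠ[𝓝 t] Icc 0 T := by
  filter_upwards [Ioi_mem_nhds ht.1] with u hu
  exact propext ⟨fun h => ⟨h.1.le, h.2⟩, fun h => ⟨hu, h.2⟩⟩

theorem continuousOn_driftCoeff (hs : IsNoiseSchedule T α σ) (hT : 0 < T) :
    ContinuousOn (driftCoeff T α) (Icc 0 T) :=
  (hs.contDiffOn_alpha.log fun t ht => (hs.alpha_pos t ht).ne').continuousOn_derivWithin
    (uniqueDiffOn_Icc hT) le_rfl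

/-- `α' = f α`. -/
theorem hasDerivAt_alpha (hs : IsNoiseSchedule T α σ) {t : ℝ} (ht : t ∈ Ioo 0 T) :
    HasDerivAt α (α t * driftCoeff T α t) t := by
  have hI := Ioo_subset_Icc_self ht
  have hα := hs.alpha_pos t hI
  have h1 : HasDerivWithinAt α (derivWithin α (Icc 0 T) t) (Icc 0 T) t :=
    ((hs.contDiffOn_alpha.differentiableOn one_ne_zero) t hI).hasDerivWithinAt
  have h2 : driftCoeff T α t = derivWithin α (Icc 0 T) t / α t :=
    (h1.log hα.ne').derivWithin (uniqueDiffOn_Icc (ht.1.trans ht.2) t hI)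
  rw [h2, mul_div_cancel₀ _ hα.ne']
  exact h1.hasDerivAt (Icc_mem_nhds ht.1 ht.2)

theorem contDiffOn_halfLogSNR (hs : IsNoiseSchedule T α σ) :
    ContDiffOn ℝ 1 (halfLogSNR α σ) (Ioc 0 T) :=
  ((hs.contDiffOn_alpha.mono Ioc_subset_Icc_self).div hs.contDiffOn_sigma
    fun t ht => (hs.sigma_pos t ht).ne').log fun t ht =>
      (div_pos (hs.alpha_pos t (Ioc_subset_Icc_self ht)) (hs.sigma_pos t ht)).ne'

theorem hasDerivWithinAt_halfLogSNR (hs : IsNoiseSchedule T α σ) {t : ℝ} (ht : t ∈ Ioc 0 T) :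
    HasDerivWithinAt (halfLogSNR α σ) (derivWithin (halfLogSNR α σ) (Ioc 0 T) t) (Ioc 0 T) t :=
  ((hs.contDiffOn_halfLogSNR.differentiableOn one_ne_zero) t ht).hasDerivWithinAt

theorem hasDerivAt_halfLogSNR (hs : IsNoiseSchedule T α σ) {t : ℝ} (ht : t ∈ Ioo 0 T) :
    HasDerivAt (halfLogSNR α σ) (derivWithin (halfLogSNR α σ) (Ioc 0 T) t) t :=
  (hs.hasDerivWithinAt_halfLogSNR (Ioo_subset_Ioc_self ht)).hasDerivAt (Ioc_mem_nhds ht.1 ht.2)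

theorem continuousOn_derivWithin_halfLogSNR (hs : IsNoiseSchedule T α σ) :
    ContinuousOn (derivWithin (halfLogSNR α σ) (Ioc 0 T)) (Ioc 0 T) :=
  hs.contDiffOn_halfLogSNR.continuousOn_derivWithin (uniqueDiffOn_Ioc 0 T) le_rfl

theorem derivWithin_halfLogSNR_nonpos (hs : IsNoiseSchedule T α σ) (t : ℝ) :
    derivWithin (halfLogSNR α σ) (Ioc 0 T) t ≤ 0 :=
  hs.strictAntiOn_halfLogSNR.antitoneOn.derivWithin_nonpos

theorem alpha_mul_exp_neg_halfLogSNR (hs : IsNoiseSchedule T α σ) {t : ℝ} (ht : t ∈ Ioc 0 T) :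
    α t * Real.exp (-halfLogSNR α σ t) = σ t := by
  have hα := hs.alpha_pos t (Ioc_subset_Icc_self ht)
  rw [halfLogSNR, Real.exp_neg, Real.exp_log (div_pos hα (hs.sigma_pos t ht)), inv_div,
    mul_div_cancel₀ _ hα.ne']

/-- `g² = - 2 σ² λ'`. -/
theorem diffusionCoeffSq_eq (hs : IsNoiseSchedule T α σ) {t : ℝ} (ht : t ∈ Ioc 0 T) :
    diffusionCoeffSq T α σ t = -2 * σ t ^ 2 * derivWithin (halfLogSNR α σ) (Ioc 0 T) t := by
  have hI := Ioc_subset_Icc_self ht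
  have hα := hs.alpha_pos t hI
  have hσ := hs.sigma_pos t ht
  have hu := uniqueDiffOn_Ioc 0 T t ht
  have h1 : HasDerivWithinAt α (derivWithin α (Ioc 0 T) t) (Ioc 0 T) t :=
    (((hs.contDiffOn_alpha.mono Ioc_subset_Icc_self).differentiableOn one_ne_zero) t
      ht).hasDerivWithinAt
  have h2 : HasDerivWithinAt σ (derivWithin σ (Ioc 0 T) t) (Ioc 0 T) t :=
    ((hs.contDiffOn_sigma.differentiableOn one_ne_zero) t ht).hasDerivWithinAt
  have h3 : derivWithin (halfLogSNR α σ) (Ioc 0 T) t = _ :=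
    ((h1.div h2 hσ.ne').log (div_pos hα hσ).ne').derivWithin hu
  rw [diffusionCoeffSq, ← derivWithin_congr_set (Ioc_eventuallyEq_Icc ht),
    ← derivWithin_congr_set (Ioc_eventuallyEq_Icc ht), (h2.fun_pow 2).derivWithin hu,
    (h1.log hα.ne').derivWithin hu, h3]
  simp only [Pi.div_apply]
  field_simp
  ring

/-- `g² / σ = - 2 σ λ'`. -/
theorem diffusionCoeff_sq_div_eq (hs : IsNoiseSchedule T α σ) {t : ℝ} (ht : t ∈ Ioc 0 T) :
    diffusionCoeff T α σ t ^ 2 / σ t =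
      -2 * σ t * derivWithin (halfLogSNR α σ) (Ioc 0 T) t := by
  have hσ := hs.sigma_pos t ht
  have h0 : 0 ≤ diffusionCoeffSq T α σ t := by
    rw [hs.diffusionCoeffSq_eq ht]
    nlinarith [mul_nonneg (sq_nonneg (σ t)) (neg_nonneg.2 (hs.derivWithin_halfLogSNR_nonpos t))]
  rw [diffusionCoeff, Real.sq_sqrt h0, hs.diffusionCoeffSq_eq ht]
  field_simp

theorem diffusionCoeff_sq_div_nonneg (hs : IsNoiseSchedule T α σ) {t : ℝ} (ht : t ∈ Ioc 0 T) :
    0 ≤ diffusionCoeff T α σ t ^ 2 / σ t :=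
  div_nonneg (sq_nonneg _) (hs.sigma_pos t ht).le

theorem continuousOn_diffusionCoeff_sq_div (hs : IsNoiseSchedule T α σ) :
    ContinuousOn (fun t => diffusionCoeff T α σ t ^ 2 / σ t) (Ioc 0 T) := by
  refine ContinuousOn.congr ?_ fun t ht => hs.diffusionCoeff_sq_div_eq ht
  exact (continuousOn_const.mul hs.contDiffOn_sigma.continuousOn).mul
    hs.continuousOn_derivWithin_halfLogSNR

/-- The coefficient `g² / σ` is integrable up to time `0`: it is `2 α` times the derivative of the
increasing function `σ / α`, which is continuous on `[0, T]`. -/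
theorem intervalIntegrable_diffusionCoeff_sq_div (hs : IsNoiseSchedule T α σ) (hT : 0 < T) :
    IntervalIntegrable (fun t => diffusionCoeff T α σ t ^ 2 / σ t) volume 0 T := by
  have h1 : IntervalIntegrable (fun t => σ t / α t *
      -derivWithin (halfLogSNR α σ) (Ioc 0 T) t) volume 0 T := by
    refine intervalIntegral.intervalIntegrable_deriv_of_nonneg (g := fun t => σ t / α t) ?_ ?_ ?_
    · rw [uIcc_of_le hT.le]
      exact hs.continuousOn_sigma.div hs.contDiffOn_alpha.continuousOn
        fun t ht => (hs.alpha_pos t ht).ne'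
    · rw [min_eq_left hT.le, max_eq_right hT.le]
      have key : ∀ u ∈ Ioo 0 T, σ u / α u = Real.exp (-halfLogSNR α σ u) := fun u hu => by
        rw [← hs.alpha_mul_exp_neg_halfLogSNR (Ioo_subset_Ioc_self hu),
          mul_div_cancel_left₀ _ (hs.alpha_pos u (Ioo_subset_Icc_self hu)).ne']
      intro t ht
      refine (((hs.hasDerivAt_halfLogSNR ht).neg.exp).congr_of_eventuallyEq ?_).congr_deriv ?_
      · filter_upwards [isOpen_Ioo.mem_nhds ht] with u hu using key u hu
      · rw [key t ht]
        rfl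
    · rw [min_eq_left hT.le, max_eq_right hT.le]
      intro t ht
      exact mul_nonneg (div_nonneg (hs.sigma_pos t (Ioo_subset_Ioc_self ht)).le
        (hs.alpha_pos t (Ioo_subset_Icc_self ht)).le)
        (neg_nonneg.2 (hs.derivWithin_halfLogSNR_nonpos t))
  have h2 := h1.continuousOn_mul (g := fun t => 2 * α t) (by
    rw [uIcc_of_le hT.le]
    exact continuousOn_const.mul hs.contDiffOn_alpha.continuousOn)
  refine h2.congr fun t ht => ?_
  rw [uIoc_of_le hT.le] at ht
  have hα := hs.alpha_pos t (Ioc_subset_Icc_self ht)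
  rw [hs.diffusionCoeff_sq_div_eq ht]
  field_simp

theorem timeOfLogSNR_halfLogSNR (hs : IsNoiseSchedule T α σ) {t : ℝ} (ht : t ∈ Ioc 0 T) :
    timeOfLogSNR T α σ (halfLogSNR α σ t) = t :=
  hs.strictAntiOn_halfLogSNR.injOn.leftInvOn_invFunOn ht

/-- The substitution `l = λ_u`. -/
theorem intervalIntegral_halfLogSNR (hs : IsNoiseSchedule T α σ) {V : Type*}
    [NormedAddCommGroup V] [NormedSpace ℝ V] {t s : ℝ} (ht : 0 < t) (hts : t ≤ s) (hsT : s ≤ T)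
    {g h : ℝ → V} (hgh : ∀ u ∈ Ioc 0 T, g (halfLogSNR α σ u) = h u)
    (hh : ContinuousOn h (Icc t s)) :
    IntervalIntegrable g volume (halfLogSNR α σ t) (halfLogSNR α σ s) ∧
      ∫ l in (halfLogSNR α σ t)..(halfLogSNR α σ s), g l =
        ∫ u in t..s, derivWithin (halfLogSNR α σ) (Ioc 0 T) u • h u := by
  have hsub : Icc t s ⊆ Ioc 0 T := fun u hu => ⟨ht.trans_le hu.1, hu.2.trans hsT⟩
  have hc : ContinuousOn (halfLogSNR α σ) (uIcc t s) := by
    rw [uIcc_of_le hts]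
    exact hs.contDiffOn_halfLogSNR.continuousOn.mono hsub
  have hd : ∀ u ∈ Ioo (min t s) (max t s), HasDerivAt (halfLogSNR α σ)
      (derivWithin (halfLogSNR α σ) (Ioc 0 T) u) u := by
    rw [min_eq_left hts, max_eq_right hts]
    exact fun u hu => hs.hasDerivAt_halfLogSNR ⟨ht.trans hu.1, hu.2.trans_le hsT⟩
  have hn : ∀ u ∈ Ioo (min t s) (max t s), derivWithin (halfLogSNR α σ) (Ioc 0 T) u ≤ 0 :=
    fun u _ => hs.derivWithin_halfLogSNR_nonpos u
  constructor
  · rw [← intervalIntegral.integrable_deriv_smul_comp_iff_of_deriv_nonpos hc hd hn]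
    refine (ContinuousOn.intervalIntegrable (u := fun u =>
      derivWithin (halfLogSNR α σ) (Ioc 0 T) u • h u) ?_).congr fun u hu => ?_
    · rw [uIcc_of_le hts]
      exact (hs.continuousOn_derivWithin_halfLogSNR.mono hsub).smul hh
    · rw [uIoc_of_le hts] at hu
      rw [Function.comp_apply, hgh u (hsub (Ioc_subset_Icc_self hu))]
  · rw [← intervalIntegral.integral_deriv_smul_comp_of_deriv_nonpos hc hd hn]
    refine intervalIntegral.integral_congr fun u hu => ?_
    rw [uIcc_of_le hts] at hu
    rw [Function.comp_apply, hgh u (hsub hu)]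

end IsNoiseSchedule

/-! ### The drift as a regular family of vector fields -/

section Family

variable {d : ℕ} {H : Type*} [NormedAddCommGroup H] [NormedSpace ℝ H]

/-- A family `F h y v = f v • y + k v • e h y v` with continuously differentiable `e`, Lipschitz in
`y`, is regular along every continuous path, even if `k` is singular but integrable at time `0`. -/
theorem exists_isRegularFamily [ProperSpace H] {T : ℝ} (hT : 0 < T) {f k : ℝ → ℝ}
    (hf : ContinuousOn f (Icc 0 T)) (hk : ContinuousOn k (Ioc 0 T)) (hk0 : ∀ v ∈ Ioc 0 T, 0 ≤ k v)
    (hki : IntervalIntegrable k volume 0 T)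
    {e : H → EuclideanSpace ℝ (Fin d) → ℝ → EuclideanSpace ℝ (Fin d)}
    (hec : ∀ h, ContinuousOn (fun q : EuclideanSpace ℝ (Fin d) × ℝ => e h q.1 q.2)
      (univ ×ˢ Icc 0 T))
    (hey : ∀ h, ∀ v ∈ Icc 0 T, Differentiable ℝ (fun y => e h y v))
    (heh : ∀ y, ∀ v ∈ Icc 0 T, Differentiable ℝ (fun h => e h y v))
    (hyc : ContinuousOn (fun q : H × EuclideanSpace ℝ (Fin d) × ℝ =>
      fderiv ℝ (fun y => e q.1 y q.2.2) q.2.1) {q | q.2.2 ∈ Icc 0 T})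
    (hhc : ContinuousOn (fun q : H × EuclideanSpace ℝ (Fin d) × ℝ =>
      fderiv ℝ (fun h => e h q.2.1 q.2.2) q.1) {q | q.2.2 ∈ Icc 0 T})
    (h₀ : H) {C : ℝ}
    (hlip : ∀ᶠ h in 𝓝 h₀, ∀ y, ∀ v ∈ Icc 0 T, ‖fderiv ℝ (fun y => e h y v) y‖ ≤ C)
    {x : ℝ → EuclideanSpace ℝ (Fin d)} (hx : ContinuousOn x (Icc 0 T))
    {F : H → EuclideanSpace ℝ (Fin d) → ℝ → EuclideanSpace ℝ (Fin d)}
    (hF : ∀ h y v, F h y v = f v • y + k v • e h y v) :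
    ∃ κ, IsRegularFamily T F κ h₀ x (fun v => fderiv ℝ (fun y => F h₀ y v) (x v))
      (fun v => fderiv ℝ (fun h => F h (x v) v) h₀) := by
  obtain rfl : F = fun h y v => f v • y + k v • e h y v := by
    funext h y v; exact hF h y v
  have hIoc : Ioc 0 T ⊆ Icc 0 T := Ioc_subset_Icc_self
  have hC0 : 0 ≤ C := (norm_nonneg _).trans (hlip.self_of_nhds 0 0 (left_mem_Icc.2 hT.le))
  -- a bound for the parameter derivative near the path
  obtain ⟨C', hC'⟩ : ∃ C', ∀ h ∈ Metric.closedBall h₀ 1, ∀ v ∈ Icc 0 T,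
      ‖fderiv ℝ (fun h => e h (x v) v) h‖ ≤ C' := by
    have hcomp : ContinuousOn (fun q : H × ℝ => fderiv ℝ (fun h => e h (x q.2) q.2) q.1)
        (Metric.closedBall h₀ 1 ×ˢ Icc 0 T) := by
      refine hhc.comp (f := fun q : H × ℝ => (q.1, x q.2, q.2)) ?_ fun q hq => hq.2
      exact continuousOn_fst.prodMk
        ((hx.comp continuousOn_snd fun q hq => hq.2).prodMk continuousOn_snd)
    obtain ⟨C', hC'⟩ := ((isCompact_closedBall h₀ 1).prod
      isCompact_Icc).exists_bound_of_continuousOn hcomp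
    exact ⟨C', fun h hh v hv => hC' (h, v) ⟨hh, hv⟩⟩
  have hC'0 : 0 ≤ C' := (norm_nonneg _).trans
    (hC' h₀ (Metric.mem_closedBall_self zero_le_one) 0 (left_mem_Icc.2 hT.le))
  have hA : ∀ v ∈ Ioc 0 T, fderiv ℝ (fun y => f v • y + k v • e h₀ y v) (x v) =
      f v • ContinuousLinearMap.id ℝ _ + k v • fderiv ℝ (fun y => e h₀ y v) (x v) := fun v hv =>
    (((hasFDerivAt_id (x v)).const_smul (f v)).add
      ((hey h₀ v (hIoc hv) (x v)).hasFDerivAt.const_smul (k v))).fderiv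
  have hB : ∀ v ∈ Ioc 0 T, fderiv ℝ (fun h => f v • x v + k v • e h (x v) v) h₀ =
      k v • fderiv ℝ (fun h => e h (x v) v) h₀ := fun v hv =>
    (((heh (x v) v (hIoc hv) h₀).hasFDerivAt.const_smul (k v)).const_add _).fderiv
  have hxI : ContinuousOn (fun v => (h₀, x v, v)) (Ioc 0 T) :=
    continuousOn_const.prodMk ((hx.mono hIoc).prodMk continuousOn_id)
  refine ⟨fun v => |f v| + k v * (C + C'), ?_, ?_, ?_, ?_, ?_, ?_, ?_, ?_, ?_⟩
  · exact (hf.mono hIoc).abs.add (hk.mul continuousOn_const)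
  · refine IntervalIntegrable.add ?_ (hki.mul_const _)
    exact ContinuousOn.intervalIntegrable (by rw [uIcc_of_le hT.le]; exact hf.abs)
  · exact fun v hv => add_nonneg (abs_nonneg _) (mul_nonneg (hk0 v hv) (add_nonneg hC0 hC'0))
  · intro h
    have hsnd : ContinuousOn (fun q : EuclideanSpace ℝ (Fin d) × ℝ => q.2) (univ ×ˢ Ioc 0 T) :=
      continuousOn_snd
    exact (((hf.mono hIoc).comp hsnd fun q hq => hq.2).smul continuousOn_fst).add
      ((hk.comp hsnd fun q hq => hq.2).smul ((hec h).mono (prod_mono_right hIoc)))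
  · intro v hv
    have hv' := hIoc hv
    have hpair : Continuous fun q : H × EuclideanSpace ℝ (Fin d) => (q.1, q.2, v) := by fun_prop
    have hstrict := hasStrictFDerivAt_uncurry_coprod (u := (h₀, x v)) (f := fun h y => e h y v)
      (f₁ := fun h y => fderiv ℝ (fun h => e h y v) h)
      (f₂ := fun h y => fderiv ℝ (fun y => e h y v) y)
      (Eventually.of_forall fun q => (heh q.2 v hv' q.1).hasFDerivAt)
      (Eventually.of_forall fun q => (hey q.1 v hv' q.2).hasFDerivAt)
      (hhc.comp_continuous hpair fun _ => hv').continuousAt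
      (hyc.comp_continuous hpair fun _ => hv').continuousAt
    have h1 := ((hasFDerivAt_snd (𝕜 := ℝ) (p := (h₀, x v))).const_smul (f v)).add
      (hstrict.hasFDerivAt.const_smul (k v))
    refine HasFDerivAt.congr_fderiv h1 ?_
    rw [hA v hv, hB v hv]
    ext q
    · simp [Function.HasUncurry.uncurry]
    · simp [Function.HasUncurry.uncurry]
  · refine ContinuousOn.congr ?_ hA
    exact ((hf.mono hIoc).smul continuousOn_const).add
      (hk.smul (hyc.comp hxI fun v hv => hIoc hv))
  · refine ContinuousOn.congr ?_ hB
    exact hk.smul (hhc.comp hxI fun v hv => hIoc hv)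
  · filter_upwards [hlip] with h hh v hv y y'
    have h1 : ‖e h y v - e h y' v‖ ≤ C * ‖y - y'‖ :=
      convex_univ.norm_image_sub_le_of_norm_fderiv_le (fun z _ => hey h v (hIoc hv) z)
        (fun z _ => hh z v (hIoc hv)) (mem_univ y') (mem_univ y)
    have h2 : (f v • y + k v • e h y v) - (f v • y' + k v • e h y' v) =
        f v • (y - y') + k v • (e h y v - e h y' v) := by
      rw [smul_sub, smul_sub]; abel
    rw [h2]
    refine (norm_add_le _ _).trans ?_
    rw [norm_smul, norm_smul, Real.norm_eq_abs, Real.norm_of_nonneg (hk0 v hv)]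
    have h3 := mul_le_mul_of_nonneg_left h1 (hk0 v hv)
    have h4 := mul_nonneg (mul_nonneg (hk0 v hv) hC'0) (norm_nonneg (y - y'))
    linarith
  · filter_upwards [Metric.closedBall_mem_nhds h₀ one_pos] with h hh v hv
    have h1 : ‖e h (x v) v - e h₀ (x v) v‖ ≤ C' * ‖h - h₀‖ :=
      (convex_closedBall h₀ 1).norm_image_sub_le_of_norm_fderiv_le
        (fun z _ => heh (x v) v (hIoc hv) z) (fun z hz => hC' z hz v (hIoc hv))
        (Metric.mem_closedBall_self zero_le_one) hh
    rw [add_sub_add_left_eq_sub, ← smul_sub, norm_smul, Real.norm_of_nonneg (hk0 v hv)]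
    have h3 := mul_le_mul_of_nonneg_left h1 (hk0 v hv)
    have h4 := mul_nonneg (mul_nonneg (hk0 v hv) hC0) (norm_nonneg (h - h₀))
    have h5 := mul_nonneg (abs_nonneg (f v)) (norm_nonneg (h - h₀))
    linarith

end Family

/-! ### Stratonovich equations without noise -/

section Noiseless

variable {Ω : Type*} [MeasurableSpace Ω] {d : ℕ} {V : Type*} [NormedAddCommGroup V]
  [NormedSpace ℝ V]

theorem exists_isPartition {s t δ : ℝ} (hst : s ≤ t) (hδ : 0 < δ) :
    ∃ n q, IsPartition s t n q ∧ ∀ k < n, q (k + 1) - q k < δ := by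
  obtain ⟨n, hn⟩ := exists_nat_gt ((t - s) / δ)
  have hn0 : (0 : ℝ) < n := (div_nonneg (sub_nonneg.2 hst) hδ.le).trans_lt hn
  have hstep : ∀ k : ℕ, (s + (t - s) / n * (k + 1 : ℕ)) - (s + (t - s) / n * k) = (t - s) / n :=
    fun k => by push_cast; ring
  refine ⟨n, fun k => s + (t - s) / n * k, ⟨by simp, ?_, fun k _ => ?_⟩, fun k _ => ?_⟩
  · rw [div_mul_cancel₀ _ hn0.ne', add_sub_cancel]
  · rw [← sub_nonneg, hstep]
    exact div_nonneg (sub_nonneg.2 hst) hn0.le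
  · rw [hstep, div_lt_comm₀ hn0 hδ]
    exact hn

/-- The Stratonovich integral of the zero integrand vanishes. -/
theorem IsStratonovichIntegral.ae_eq_zero {P : Measure Ω} {w : ℝ → Ω → EuclideanSpace ℝ (Fin d)}
    {s t : ℝ} (hst : s ≤ t) {I : Ω → V}
    (hI : IsStratonovichIntegral P w (fun _ _ => 0) s t I) : ∀ᵐ ω ∂P, I ω = 0 := by
  have h0 : ∀ ε : ℝ, 0 < ε → P {ω | ε ≤ ‖I ω‖} = 0 := by
    intro ε hε
    refine le_antisymm (le_of_forall_pos_le_add fun η hη => ?_) zero_le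
    rcases eq_or_ne η ⊤ with rfl | hη'
    · simp
    obtain ⟨δ, hδ, h⟩ := hI ε hε η.toReal (ENNReal.toReal_pos hη.ne' hη')
    obtain ⟨n, q, hq, hmesh⟩ := exists_isPartition hst hδ
    have := h n q hq hmesh
    rw [ENNReal.ofReal_toReal hη'] at this
    simpa using this
  have h1 : ∀ᵐ ω ∂P, ∀ n : ℕ, ‖I ω‖ < 1 / ((n : ℝ) + 1) := by
    refine ae_all_iff.2 fun n => ?_
    rw [ae_iff]
    simpa using h0 _ (Nat.one_div_pos_of_nat (α := ℝ) (n := n))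
  filter_upwards [h1] with ω hω
  by_contra hne
  obtain ⟨n, hn⟩ := exists_nat_one_div_lt (norm_pos_iff.2 hne)
  exact lt_asymm hn (hω n)

/-- The path `a` solves `da = b ds` on `[t, T]` in integrated form. -/
def IsIntegralSolution (t T : ℝ) (a b : ℝ → V) : Prop :=
  ContinuousOn a (Icc t T) ∧ ∀ s ∈ Icc t T, IntervalIntegrable b volume t s ∧
    a s = a t + ∫ u in t..s, b u

/-- A Stratonovich equation without noise term is a pathwise integral equation. The exceptional set
is chosen independently of the time because the paths are continuous. -/
theorem solvesStratonovich_zero_iff {P : Measure Ω} {w : ℝ → Ω → EuclideanSpace ℝ (Fin d)}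
    {t T : ℝ} (htT : t < T) {a b : ℝ → Ω → V} :
    SolvesStratonovich P w t T a b (fun _ _ => 0) ↔
      ∀ᵐ ω ∂P, IsIntegralSolution t T (fun s => a s ω) (fun s => b s ω) := by
  constructor
  · rintro ⟨hc, J, hJc, hJ, h⟩
    have h0 : ∀ᵐ ω ∂P, ∀ r : ℚ, (r : ℝ) ∈ Ioo t T → J r ω = 0 :=
      ae_all_iff.2 fun r => by
        by_cases hr : (r : ℝ) ∈ Ioo t T
        · filter_upwards [(hJ r (Ioo_subset_Icc_self hr)).ae_eq_zero hr.1.le] with ω hω _ using hω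
        · exact Eventually.of_forall fun ω h => (hr h).elim
    filter_upwards [hc, hJc, h, h0] with ω h1 h2 h3 h4
    have hdense : Icc t T ⊆ closure (Ioo t T ∩ range ((↑) : ℚ → ℝ)) := by
      rw [← closure_Ioo htT.ne]
      exact closure_minimal (Rat.denseRange_cast.open_subset_closure_inter isOpen_Ioo)
        isClosed_closure
    have h5 : EqOn (fun s => J s ω) (fun _ => 0) (Icc t T) := by
      refine EqOn.of_subset_closure (s := Ioo t T ∩ range ((↑) : ℚ → ℝ)) ?_ h2 continuousOn_const
        (inter_subset_left.trans Ioo_subset_Icc_self) hdense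
      rintro _ ⟨hr, r, rfl⟩
      exact h4 r hr
    refine ⟨h1, fun s hs => ⟨(h3 s hs).1, ?_⟩⟩
    exact ((h3 s hs).2.trans (congrArg _ (h5 hs))).trans (add_zero _)
  · intro h
    refine ⟨h.mono fun ω hω => hω.1, fun _ _ => 0, Eventually.of_forall fun _ => continuousOn_const,
      fun s _ ε hε η _ => ⟨1, one_pos, fun n q _ _ => ?_⟩, h.mono fun ω hω s hs => ?_⟩
    · simp [hε.not_ge]
    · simpa using hω.2 s hs

end Noiseless

/-! ### Pathwise integral equations -/

section Pathwise

variable {V : Type*} [NormedAddCommGroup V] [NormedSpace ℝ V] {t T : ℝ}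

namespace IsIntegralSolution

theorem congr {a a' b b' : ℝ → V} (h : IsIntegralSolution t T a b) (htT : t ≤ T)
    (ha : ∀ u ∈ Icc t T, a' u = a u) (hb : ∀ u ∈ Icc t T, b' u = b u) :
    IsIntegralSolution t T a' b' := by
  refine ⟨h.1.congr ha, fun s hs => ?_⟩
  obtain ⟨h1, h2⟩ := h.2 s hs
  have hsub : uIcc t s ⊆ Icc t T := by
    rw [uIcc_of_le hs.1]; exact Icc_subset_Icc_right hs.2
  refine ⟨h1.congr fun u hu => (hb u (hsub (uIoc_subset_uIcc hu))).symm, ?_⟩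
  rw [ha s hs, ha t (left_mem_Icc.2 htT), h2]
  congr 1
  exact intervalIntegral.integral_congr fun u hu => (hb u (hsub hu)).symm

theorem hasDerivAt [CompleteSpace V] {a b : ℝ → V} (h : IsIntegralSolution t T a b)
    (hb : ContinuousOn b (Icc t T)) {u : ℝ} (hu : u ∈ Ioo t T) : HasDerivAt a (b u) u := by
  have htT : t ≤ T := (hu.1.trans hu.2).le
  refine ((hasDerivAt_primitive_Ioo (h.2 T (right_mem_Icc.2 htT)).1
    (hb.mono Ioo_subset_Icc_self) hu).const_add (a t)).congr_of_eventuallyEq ?_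
  filter_upwards [isOpen_Ioo.mem_nhds hu] with v hv
  exact (h.2 v (Ioo_subset_Icc_self hv)).2

theorem exists_of_continuousOn {b : ℝ → V} (htT : t ≤ T) (hb : ContinuousOn b (Icc t T)) (a₀ : V) :
    ∃ a : ℝ → V, a t = a₀ ∧ IsIntegralSolution t T a b := by
  have hi : IntervalIntegrable b volume t T :=
    ContinuousOn.intervalIntegrable (by rwa [uIcc_of_le htT])
  refine ⟨fun s => a₀ + ∫ u in t..s, b u, by simp,
    continuousOn_const.add (continuousOn_primitive_Icc htT hi), fun s hs => ⟨?_, by simp⟩⟩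
  exact intervalIntegrable_mono_Icc htT hi (left_mem_Icc.2 htT) hs

/-- The image under a continuous linear map of a primitive that starts at time `0`. -/
theorem of_primitive [CompleteSpace V] {V' : Type*} [NormedAddCommGroup V'] [NormedSpace ℝ V']
    [CompleteSpace V'] {c g : ℝ → V} {c₀ : V} (ht : t ∈ Icc 0 T)
    (hg : IntervalIntegrable g volume 0 T)
    (hc : ∀ s ∈ Icc 0 T, c s = c₀ + ∫ u in (0 : ℝ)..s, g u) (Λ : V →L[ℝ] V') :
    IsIntegralSolution t T (fun s => Λ (c s)) (fun s => Λ (g s)) := by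
  have h0T : 0 ≤ T := ht.1.trans ht.2
  have hsub : Icc t T ⊆ Icc 0 T := Icc_subset_Icc_left ht.1
  refine ⟨?_, fun s hs => ?_⟩
  · exact Λ.continuous.comp_continuousOn
      (((continuousOn_const.add (continuousOn_primitive_Icc h0T hg)).congr hc).mono hsub)
  have hi := intervalIntegrable_mono_Icc h0T hg ht (hsub hs)
  refine ⟨⟨Λ.integrable_comp hi.1, Λ.integrable_comp hi.2⟩, ?_⟩
  change Λ (c s) = _
  rw [Λ.intervalIntegral_comp_comm hi, ← map_add, hc s (hsub hs), hc t ht,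
    ← intervalIntegral.integral_add_adjacent_intervals
      (intervalIntegrable_mono_Icc h0T hg (left_mem_Icc.2 h0T) ht) hi, add_assoc]

variable {E : Type*} [NormedAddCommGroup E] [NormedSpace ℝ E] {A : ℝ → E →L[ℝ] E}

theorem exists_adjoint (htT : t ≤ T) (hA : ContinuousOn A (Icc t T)) (a₀ : E →L[ℝ] ℝ) :
    ∃ a : ℝ → E →L[ℝ] ℝ, a t = a₀ ∧ IsIntegralSolution t T a (fun u => -(a u).comp (A u)) := by
  -- right composition with `- A u`, as an operator on row vectors
  set 𝒜 : ℝ → (E →L[ℝ] ℝ) →L[ℝ] (E →L[ℝ] ℝ) :=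
    fun u => -(ContinuousLinearMap.compL ℝ E E ℝ).flip (A u) with h𝒜
  have h𝒜c : ContinuousOn 𝒜 (Icc t T) :=
    ((ContinuousLinearMap.compL ℝ E E ℝ).flip.continuous.comp_continuousOn hA).neg
  obtain ⟨M, hM⟩ := isCompact_Icc.exists_bound_of_continuousOn (f := 𝒜) h𝒜c
  obtain ⟨a, hac, ha⟩ := exists_linear_integral_solution (κ := fun _ => M) htT
    (h𝒜c.mono Ioc_subset_Icc_self) continuousOn_const intervalIntegrable_const
    (fun v hv => hM v (Ioc_subset_Icc_self hv)) a₀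
  have hat : a t = a₀ := by simpa using ha t (left_mem_Icc.2 htT)
  refine ⟨a, hat, hac, fun s hs => ⟨ContinuousOn.intervalIntegrable ?_, ?_⟩⟩
  · rw [uIcc_of_le hs.1]
    exact (hac.clm_comp hA).neg.mono (Icc_subset_Icc_right hs.2)
  · rw [hat]
    exact ha s hs

theorem adjoint_unique (hA : ContinuousOn A (Icc t T)) {a a' : ℝ → E →L[ℝ] ℝ}
    (ha : IsIntegralSolution t T a (fun u => -(a u).comp (A u)))
    (ha' : IsIntegralSolution t T a' (fun u => -(a' u).comp (A u))) (h : a t = a' t) {s : ℝ}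
    (hs : s ∈ Icc t T) : a s = a' s := by
  have htT : t ≤ T := hs.1.trans hs.2
  obtain ⟨M, hM⟩ := isCompact_Icc.exists_bound_of_continuousOn hA
  have hM0 : 0 ≤ M := (norm_nonneg _).trans (hM s hs)
  have hδ : ContinuousOn (fun u => ‖a u - a' u‖) (Icc t T) := (ha.1.sub ha'.1).norm
  have key := gronwall_integral_le (κ := fun _ => M) (C := 0) htT hδ continuousOn_const
    intervalIntegrable_const (fun _ _ => hM0) (fun s hs => ?_) hs
  · rw [zero_mul] at key
    exact sub_eq_zero.1 (norm_le_zero_iff.1 key)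
  · obtain ⟨h1, h2⟩ := ha.2 s hs
    obtain ⟨h1', h2'⟩ := ha'.2 s hs
    rw [h2, h2', h, add_sub_add_left_eq_sub, ← intervalIntegral.integral_sub h1 h1', zero_add]
    refine intervalIntegral.norm_integral_le_of_norm_le hs.1
      (Eventually.of_forall fun u hu => ?_) ?_
    · have hu' : u ∈ Icc t T := ⟨hu.1.le, hu.2.trans hs.2⟩
      have e : -(a u).comp (A u) - -(a' u).comp (A u) = -(a u - a' u).comp (A u) := by
        rw [ContinuousLinearMap.sub_comp]; abel
      rw [e, norm_neg, mul_comm]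
      exact ((a u - a' u).opNorm_comp_le _).trans
        (mul_le_mul_of_nonneg_left (hM u hu') (norm_nonneg _))
    · refine ContinuousOn.intervalIntegrable ?_
      rw [uIcc_of_le hs.1]
      exact continuousOn_const.mul (hδ.mono (Icc_subset_Icc_right hs.2))

end IsIntegralSolution

end Pathwise

/-! ### The exact formulas -/

namespace IsNoiseSchedule

variable {T t s : ℝ} {α σ : ℝ → ℝ} {E H : Type*} [NormedAddCommGroup E] [NormedSpace ℝ E]
  [NormedAddCommGroup H] [NormedSpace ℝ H] {a : ℝ → E →L[ℝ] ℝ}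

/-- Variation of constants: `d(α a) = 2 α σ λ' (a D) du`, and `α σ = α² exp (-λ)`. -/
theorem adjoint_state_formula (hsch : IsNoiseSchedule T α σ) (ht : 0 < t) (hs : s ∈ Ioc t T)
    {D : ℝ → E →L[ℝ] E} (hD : ContinuousOn D (Icc t T))
    (ha : IsIntegralSolution t T a (fun u => -(a u).comp (driftCoeff T α u •
      ContinuousLinearMap.id ℝ E + (diffusionCoeff T α σ u ^ 2 / σ u) • D u))) :
    IntervalIntegrable (fun l => (α (timeOfLogSNR T α σ l) ^ 2 * Real.exp (-l)) •
        (a (timeOfLogSNR T α σ l)).comp (D (timeOfLogSNR T α σ l)))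
      volume (halfLogSNR α σ t) (halfLogSNR α σ s) ∧
    a s = (α t / α s) • a t + (2 / α s) • ∫ l in (halfLogSNR α σ t)..(halfLogSNR α σ s),
      (α (timeOfLogSNR T α σ l) ^ 2 * Real.exp (-l)) •
        (a (timeOfLogSNR T α σ l)).comp (D (timeOfLogSNR T α σ l)) := by
  have hT : 0 < T := ht.trans (hs.1.trans_le hs.2)
  have hsub : Icc t s ⊆ Icc t T := Icc_subset_Icc_right hs.2
  have hsub0 : Icc t T ⊆ Ioc 0 T := fun u hu => ⟨ht.trans_le hu.1, hu.2⟩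
  have hαc : ContinuousOn α (Icc t T) :=
    hsch.contDiffOn_alpha.continuousOn.mono (hsub0.trans Ioc_subset_Icc_self)
  have hσc : ContinuousOn σ (Icc t T) := hsch.contDiffOn_sigma.continuousOn.mono hsub0
  have hQ : ContinuousOn (fun u => (α u * σ u) • (a u).comp (D u)) (Icc t s) :=
    ((hαc.mul hσc).smul (ha.1.clm_comp hD)).mono hsub
  obtain ⟨hi, he⟩ := hsch.intervalIntegral_halfLogSNR ht hs.1.le hs.2
    (g := fun l => (α (timeOfLogSNR T α σ l) ^ 2 * Real.exp (-l)) •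
        (a (timeOfLogSNR T α σ l)).comp (D (timeOfLogSNR T α σ l)))
    (h := fun u => (α u * σ u) • (a u).comp (D u))
    (fun u hu => by
      rw [hsch.timeOfLogSNR_halfLogSNR hu, ← hsch.alpha_mul_exp_neg_halfLogSNR hu, pow_two,
        mul_assoc]) hQ
  refine ⟨hi, ?_⟩
  rw [he]
  have hc : ContinuousOn (fun u => -(a u).comp (driftCoeff T α u •
      ContinuousLinearMap.id ℝ E + (diffusionCoeff T α σ u ^ 2 / σ u) • D u)) (Icc t T) := by
    refine (ha.1.clm_comp (ContinuousOn.add ?_ ?_)).neg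
    · exact ((hsch.continuousOn_driftCoeff hT).mono
        (hsub0.trans Ioc_subset_Icc_self)).smul continuousOn_const
    · exact (hsch.continuousOn_diffusionCoeff_sq_div.mono hsub0).smul hD
  have key : ∫ u in t..s, (2 : ℝ) • (derivWithin (halfLogSNR α σ) (Ioc 0 T) u •
      ((α u * σ u) • (a u).comp (D u))) = α s • a s - α t • a t := by
    refine intervalIntegral.integral_eq_sub_of_hasDerivAt_of_le (f := fun u => α u • a u) hs.1.le
      ((hαc.smul ha.1).mono hsub) (fun u hu => ?_) (ContinuousOn.intervalIntegrable ?_)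
    · have huT : u ∈ Ioo t T := ⟨hu.1, hu.2.trans_le hs.2⟩
      have hu0 : u ∈ Ioo 0 T := ⟨ht.trans hu.1, huT.2⟩
      refine ((hsch.hasDerivAt_alpha hu0).smul (ha.hasDerivAt hc huT)).congr_deriv ?_
      rw [hsch.diffusionCoeff_sq_div_eq (Ioo_subset_Ioc_self hu0)]
      ext v
      simp
      ring
    · rw [uIcc_of_le hs.1.le]
      exact ((hsch.continuousOn_derivWithin_halfLogSNR.mono (hsub.trans hsub0)).smul
        hQ).const_smul (2 : ℝ)
  rw [intervalIntegral.integral_smul] at key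
  have hαs : α s ≠ 0 := (hsch.alpha_pos s ⟨(ht.trans hs.1).le, hs.2⟩).ne'
  have h1 : α s • a s = α t • a t + (2 : ℝ) • ∫ u in t..s,
      derivWithin (halfLogSNR α σ) (Ioc 0 T) u • ((α u * σ u) • (a u).comp (D u)) := by
    rw [key]; abel
  rw [← inv_smul_smul₀ hαs (a s), h1, smul_add, smul_smul, smul_smul, inv_mul_eq_div,
    inv_mul_eq_div]

/-- The parameter adjoint: `- g² / σ = 2 σ λ'`, and `σ = α exp (-λ)`. -/
theorem adjoint_param_formula (hsch : IsNoiseSchedule T α σ) (ht : 0 < t) (hs : s ∈ Ioc t T)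
    (hac : ContinuousOn a (Icc t T)) {B : ℝ → H →L[ℝ] E} (hB : ContinuousOn B (Icc t T))
    {c : ℝ → H →L[ℝ] ℝ} (hc : IsIntegralSolution t T c
      (fun u => -(a u).comp ((diffusionCoeff T α σ u ^ 2 / σ u) • B u))) :
    IntervalIntegrable (fun l => (α (timeOfLogSNR T α σ l) * Real.exp (-l)) •
        (a (timeOfLogSNR T α σ l)).comp (B (timeOfLogSNR T α σ l)))
      volume (halfLogSNR α σ t) (halfLogSNR α σ s) ∧
    c s = c t + (2 : ℝ) • ∫ l in (halfLogSNR α σ t)..(halfLogSNR α σ s),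
      (α (timeOfLogSNR T α σ l) * Real.exp (-l)) •
        (a (timeOfLogSNR T α σ l)).comp (B (timeOfLogSNR T α σ l)) := by
  have hsub : Icc t s ⊆ Icc t T := Icc_subset_Icc_right hs.2
  have hsub0 : Icc t T ⊆ Ioc 0 T := fun u hu => ⟨ht.trans_le hu.1, hu.2⟩
  obtain ⟨hi, he⟩ := hsch.intervalIntegral_halfLogSNR ht hs.1.le hs.2
    (g := fun l => (α (timeOfLogSNR T α σ l) * Real.exp (-l)) •
        (a (timeOfLogSNR T α σ l)).comp (B (timeOfLogSNR T α σ l)))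
    (h := fun u => σ u • (a u).comp (B u))
    (fun u hu => by
      rw [hsch.timeOfLogSNR_halfLogSNR hu, hsch.alpha_mul_exp_neg_halfLogSNR hu])
    (((hsch.contDiffOn_sigma.continuousOn.mono hsub0).smul (hac.clm_comp hB)).mono hsub)
  refine ⟨hi, ?_⟩
  rw [he, (hc.2 s (Ioc_subset_Icc_self hs)).2, ← intervalIntegral.integral_smul]
  congr 1
  refine intervalIntegral.integral_congr fun u hu => ?_
  rw [uIcc_of_le hs.1.le] at hu
  rw [hsch.diffusionCoeff_sq_div_eq (hsub0 (hsub hu))]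
  ext v
  simp
  ring

end IsNoiseSchedule

/-! ### The adjoint states along a path -/

section Model

variable {d m p : ℕ} {T : ℝ} {α σ : ℝ → ℝ}
  {ε : EuclideanSpace ℝ (Fin p) → EuclideanSpace ℝ (Fin d) → EuclideanSpace ℝ (Fin m) → ℝ →
    EuclideanSpace ℝ (Fin d)}
  {θ : EuclideanSpace ℝ (Fin p)} {z : EuclideanSpace ℝ (Fin m)}
  {x : ℝ → EuclideanSpace ℝ (Fin d)}

theorem fderiv_sdeDrift_state (hε : IsRegularNoiseModel T ε) {u : ℝ} (hu : u ∈ Icc 0 T)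
    (y : EuclideanSpace ℝ (Fin d)) :
    fderiv ℝ (fun y => sdeDrift T α σ ε θ y z u) y =
      driftCoeff T α u • ContinuousLinearMap.id ℝ (EuclideanSpace ℝ (Fin d)) +
        (diffusionCoeff T α σ u ^ 2 / σ u) • fderiv ℝ (fun y => ε θ y z u) y :=
  (((hasFDerivAt_id y).const_smul (driftCoeff T α u)).add
    ((hε.differentiable_x θ z u hu y).hasFDerivAt.const_smul
      (diffusionCoeff T α σ u ^ 2 / σ u))).fderiv

theorem fderiv_sdeDrift_cond (hε : IsRegularNoiseModel T ε) {u : ℝ} (hu : u ∈ Icc 0 T)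
    (y : EuclideanSpace ℝ (Fin d)) :
    fderiv ℝ (fun z => sdeDrift T α σ ε θ y z u) z =
      (diffusionCoeff T α σ u ^ 2 / σ u) • fderiv ℝ (fun z => ε θ y z u) z :=
  (((hε.differentiable_z θ y u hu z).hasFDerivAt.const_smul
    (diffusionCoeff T α σ u ^ 2 / σ u)).const_add (driftCoeff T α u • y)).fderiv

theorem fderiv_sdeDrift_param (hε : IsRegularNoiseModel T ε) {u : ℝ} (hu : u ∈ Icc 0 T)
    (y : EuclideanSpace ℝ (Fin d)) :
    fderiv ℝ (fun θ => sdeDrift T α σ ε θ y z u) θ =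
      (diffusionCoeff T α σ u ^ 2 / σ u) • fderiv ℝ (fun θ => ε θ y z u) θ :=
  (((hε.differentiable_theta y z u hu θ).hasFDerivAt.const_smul
    (diffusionCoeff T α σ u ^ 2 / σ u)).const_add (driftCoeff T α u • y)).fderiv

theorem IsRegularNoiseModel.continuousOn_fderiv_x_comp (hε : IsRegularNoiseModel T ε)
    (hx : ContinuousOn x (Icc 0 T)) :
    ContinuousOn (fun u => fderiv ℝ (fun y => ε θ y z u) (x u)) (Icc 0 T) :=
  hε.continuousOn_fderiv_x.comp (f := fun u => (θ, x u, z, u))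
    (continuousOn_const.prodMk (hx.prodMk (continuousOn_const.prodMk continuousOn_id)))
    fun _ hu => hu

theorem IsRegularNoiseModel.continuousOn_fderiv_z_comp (hε : IsRegularNoiseModel T ε)
    (hx : ContinuousOn x (Icc 0 T)) :
    ContinuousOn (fun u => fderiv ℝ (fun z => ε θ (x u) z u) z) (Icc 0 T) :=
  hε.continuousOn_fderiv_z.comp (f := fun u => (θ, x u, z, u))
    (continuousOn_const.prodMk (hx.prodMk (continuousOn_const.prodMk continuousOn_id)))
    fun _ hu => hu

theorem IsRegularNoiseModel.continuousOn_fderiv_theta_comp (hε : IsRegularNoiseModel T ε)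
    (hx : ContinuousOn x (Icc 0 T)) :
    ContinuousOn (fun u => fderiv ℝ (fun θ => ε θ (x u) z u) θ) (Icc 0 T) :=
  hε.continuousOn_fderiv_theta.comp (f := fun u => (θ, x u, z, u))
    (continuousOn_const.prodMk (hx.prodMk (continuousOn_const.prodMk continuousOn_id)))
    fun _ hu => hu

theorem continuousOn_fderiv_sdeDrift_state (hsch : IsNoiseSchedule T α σ) (hT : 0 < T)
    (hε : IsRegularNoiseModel T ε) (hx : ContinuousOn x (Icc 0 T)) :
    ContinuousOn (fun u => fderiv ℝ (fun y => sdeDrift T α σ ε θ y z u) (x u)) (Ioc 0 T) := by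
  refine ContinuousOn.congr ?_ fun u hu => fderiv_sdeDrift_state hε (Ioc_subset_Icc_self hu) (x u)
  exact (((hsch.continuousOn_driftCoeff hT).mono Ioc_subset_Icc_self).smul continuousOn_const).add
    (hsch.continuousOn_diffusionCoeff_sq_div.smul
      ((hε.continuousOn_fderiv_x_comp hx).mono Ioc_subset_Icc_self))

theorem continuousOn_fderiv_sdeDrift_cond (hsch : IsNoiseSchedule T α σ)
    (hε : IsRegularNoiseModel T ε) (hx : ContinuousOn x (Icc 0 T)) :
    ContinuousOn (fun u => fderiv ℝ (fun z => sdeDrift T α σ ε θ (x u) z u) z) (Ioc 0 T) := by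
  refine ContinuousOn.congr ?_ fun u hu => fderiv_sdeDrift_cond hε (Ioc_subset_Icc_self hu) (x u)
  exact hsch.continuousOn_diffusionCoeff_sq_div.smul
    ((hε.continuousOn_fderiv_z_comp hx).mono Ioc_subset_Icc_self)

theorem continuousOn_fderiv_sdeDrift_param (hsch : IsNoiseSchedule T α σ)
    (hε : IsRegularNoiseModel T ε) (hx : ContinuousOn x (Icc 0 T)) :
    ContinuousOn (fun u => fderiv ℝ (fun θ => sdeDrift T α σ ε θ (x u) z u) θ) (Ioc 0 T) := by
  refine ContinuousOn.congr ?_ fun u hu => fderiv_sdeDrift_param hε (Ioc_subset_Icc_self hu) (x u)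
  exact hsch.continuousOn_diffusionCoeff_sq_div.smul
    ((hε.continuousOn_fderiv_theta_comp hx).mono Ioc_subset_Icc_self)

/-- For the dependence on the initial state `h`, the vector field itself does not depend on `h`. -/
theorem exists_isRegularFamily_state (hsch : IsNoiseSchedule T α σ) (hT : 0 < T)
    (hε : IsRegularNoiseModel T ε) (hx : ContinuousOn x (Icc 0 T))
    (θ : EuclideanSpace ℝ (Fin p)) (z : EuclideanSpace ℝ (Fin m)) (h₀ : EuclideanSpace ℝ (Fin d)) :
    ∃ κ, IsRegularFamily T (fun (_ : EuclideanSpace ℝ (Fin d)) y v => sdeDrift T α σ ε θ y z v) κ h₀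
      x (fun v => fderiv ℝ (fun y => sdeDrift T α σ ε θ y z v) (x v))
      (fun v => fderiv ℝ (fun _ => sdeDrift T α σ ε θ (x v) z v) h₀) := by
  obtain ⟨C, hC⟩ := hε.lipschitz_x (max ‖θ‖ ‖z‖)
  refine exists_isRegularFamily hT (hsch.continuousOn_driftCoeff hT)
    hsch.continuousOn_diffusionCoeff_sq_div (fun v hv => hsch.diffusionCoeff_sq_div_nonneg hv)
    (hsch.intervalIntegrable_diffusionCoeff_sq_div hT) (e := fun _ y v => ε θ y z v)
    (fun h => ?_) (fun _ v hv => hε.differentiable_x θ z v hv)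
    (fun _ _ _ => differentiable_const _) ?_ ?_ h₀ (C := C)
    (Eventually.of_forall fun h y v hv => hC θ z y v hv (le_max_left _ _) (le_max_right _ _)) hx
    (fun _ _ _ => rfl)
  · exact hε.continuousOn.comp (f := fun q : EuclideanSpace ℝ (Fin d) × ℝ => (θ, q.1, z, q.2))
      (by fun_prop) fun q hq => hq.2
  · exact hε.continuousOn_fderiv_x.comp
      (f := fun q : EuclideanSpace ℝ (Fin d) × EuclideanSpace ℝ (Fin d) × ℝ =>
        (θ, q.2.1, z, q.2.2)) (by fun_prop) fun q hq => hq
  · simpa using continuousOn_const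

theorem exists_isRegularFamily_cond (hsch : IsNoiseSchedule T α σ) (hT : 0 < T)
    (hε : IsRegularNoiseModel T ε) (hx : ContinuousOn x (Icc 0 T))
    (θ : EuclideanSpace ℝ (Fin p)) (z : EuclideanSpace ℝ (Fin m)) :
    ∃ κ, IsRegularFamily T (fun z y v => sdeDrift T α σ ε θ y z v) κ z
      x (fun v => fderiv ℝ (fun y => sdeDrift T α σ ε θ y z v) (x v))
      (fun v => fderiv ℝ (fun z => sdeDrift T α σ ε θ (x v) z v) z) := by
  obtain ⟨C, hC⟩ := hε.lipschitz_x (max ‖θ‖ (‖z‖ + 1))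
  refine exists_isRegularFamily hT (hsch.continuousOn_driftCoeff hT)
    hsch.continuousOn_diffusionCoeff_sq_div (fun v hv => hsch.diffusionCoeff_sq_div_nonneg hv)
    (hsch.intervalIntegrable_diffusionCoeff_sq_div hT) (e := fun z y v => ε θ y z v)
    (fun h => ?_) (fun z v hv => hε.differentiable_x θ z v hv)
    (fun y v hv => hε.differentiable_z θ y v hv) ?_ ?_ z (C := C) ?_ hx
    (fun _ _ _ => rfl)
  · exact hε.continuousOn.comp (f := fun q : EuclideanSpace ℝ (Fin d) × ℝ => (θ, q.1, h, q.2))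
      (by fun_prop) fun q hq => hq.2
  · exact hε.continuousOn_fderiv_x.comp
      (f := fun q : EuclideanSpace ℝ (Fin m) × EuclideanSpace ℝ (Fin d) × ℝ =>
        (θ, q.2.1, q.1, q.2.2)) (by fun_prop) fun q hq => hq
  · exact hε.continuousOn_fderiv_z.comp
      (f := fun q : EuclideanSpace ℝ (Fin m) × EuclideanSpace ℝ (Fin d) × ℝ =>
        (θ, q.2.1, q.1, q.2.2)) (by fun_prop) fun q hq => hq
  · filter_upwards [continuous_norm.continuousAt.eventually_lt
      (continuousAt_const (y := ‖z‖ + 1)) (lt_add_one _)] with h hh y v hv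
    exact hC θ h y v hv (le_max_left _ _) (hh.le.trans (le_max_right _ _))

theorem exists_isRegularFamily_param (hsch : IsNoiseSchedule T α σ) (hT : 0 < T)
    (hε : IsRegularNoiseModel T ε) (hx : ContinuousOn x (Icc 0 T))
    (θ : EuclideanSpace ℝ (Fin p)) (z : EuclideanSpace ℝ (Fin m)) :
    ∃ κ, IsRegularFamily T (fun θ y v => sdeDrift T α σ ε θ y z v) κ θ
      x (fun v => fderiv ℝ (fun y => sdeDrift T α σ ε θ y z v) (x v))
      (fun v => fderiv ℝ (fun θ => sdeDrift T α σ ε θ (x v) z v) θ) := by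
  obtain ⟨C, hC⟩ := hε.lipschitz_x (max (‖θ‖ + 1) ‖z‖)
  refine exists_isRegularFamily hT (hsch.continuousOn_driftCoeff hT)
    hsch.continuousOn_diffusionCoeff_sq_div (fun v hv => hsch.diffusionCoeff_sq_div_nonneg hv)
    (hsch.intervalIntegrable_diffusionCoeff_sq_div hT) (e := fun θ y v => ε θ y z v)
    (fun h => ?_) (fun θ v hv => hε.differentiable_x θ z v hv)
    (fun y v hv => hε.differentiable_theta y z v hv) ?_ ?_ θ (C := C) ?_ hx
    (fun _ _ _ => rfl)
  · exact hε.continuousOn.comp (f := fun q : EuclideanSpace ℝ (Fin d) × ℝ => (h, q.1, z, q.2))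
      (by fun_prop) fun q hq => hq.2
  · exact hε.continuousOn_fderiv_x.comp
      (f := fun q : EuclideanSpace ℝ (Fin p) × EuclideanSpace ℝ (Fin d) × ℝ =>
        (q.1, q.2.1, z, q.2.2)) (by fun_prop) fun q hq => hq
  · exact hε.continuousOn_fderiv_theta.comp
      (f := fun q : EuclideanSpace ℝ (Fin p) × EuclideanSpace ℝ (Fin d) × ℝ =>
        (q.1, q.2.1, z, q.2.2)) (by fun_prop) fun q hq => hq
  · filter_upwards [continuous_norm.continuousAt.eventually_lt
      (continuousAt_const (y := ‖θ‖ + 1)) (lt_add_one _)] with h hh y v hv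
    exact hC h z y v hv (hh.le.trans (le_max_left _ _)) (le_max_right _ _)

/-- The solution `Z` of `dZ = - Z A dv`, `Z 0 = 1`, along the path `x`; it turns out that `Z s` is
the derivative of the flow from time `s` to time `0`. -/
theorem IsRegularFamily.exists_adjointFlow {H : Type*} [NormedAddCommGroup H] [NormedSpace ℝ H]
    {F : H → EuclideanSpace ℝ (Fin d) → ℝ → EuclideanSpace ℝ (Fin d)} {κ : ℝ → ℝ} {h₀ : H}
    {A : ℝ → EuclideanSpace ℝ (Fin d) →L[ℝ] EuclideanSpace ℝ (Fin d)}
    {B : ℝ → H →L[ℝ] EuclideanSpace ℝ (Fin d)} (hF : IsRegularFamily T F κ h₀ x A B)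
    (hT : 0 < T) :
    ∃ Z : ℝ → EuclideanSpace ℝ (Fin d) →L[ℝ] EuclideanSpace ℝ (Fin d),
      ContinuousOn Z (Icc 0 T) ∧
      IntervalIntegrable (fun v => -(Z v).comp (A v)) volume 0 T ∧
      ∀ u ∈ Icc 0 T,
        Z u = ContinuousLinearMap.id ℝ _ + ∫ v in (0 : ℝ)..u, -(Z v).comp (A v) := by
  have hnorm : ∀ v ∈ Ioc 0 T, ‖-(ContinuousLinearMap.compL ℝ (EuclideanSpace ℝ (Fin d))
      (EuclideanSpace ℝ (Fin d)) (EuclideanSpace ℝ (Fin d))).flip (A v)‖ ≤ κ v := fun v hv => by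
    rw [norm_neg]
    refine ContinuousLinearMap.opNorm_le_bound _ (hF.bound_nonneg v hv) fun Q => ?_
    rw [mul_comm]
    exact (Q.opNorm_comp_le _).trans
      (mul_le_mul_of_nonneg_left (hF.norm_A_le hv) (norm_nonneg _))
  obtain ⟨Z, hZc, hZ⟩ := exists_linear_integral_solution hT.le
    (A := fun v => -(ContinuousLinearMap.compL ℝ (EuclideanSpace ℝ (Fin d))
      (EuclideanSpace ℝ (Fin d)) (EuclideanSpace ℝ (Fin d))).flip (A v))
    ((ContinuousLinearMap.compL ℝ (EuclideanSpace ℝ (Fin d)) (EuclideanSpace ℝ (Fin d))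
      (EuclideanSpace ℝ (Fin d))).flip.continuous.comp_continuousOn hF.continuousOn_A).neg
    hF.continuousOn_bound hF.integrable_bound hnorm
    (ContinuousLinearMap.id ℝ (EuclideanSpace ℝ (Fin d)))
  refine ⟨Z, hZc, ?_, hZ⟩
  obtain ⟨M, hM⟩ := isCompact_Icc.exists_bound_of_continuousOn hZc
  refine intervalIntegrable_of_continuousOn_Ioc hT.le
    ((hZc.mono Ioc_subset_Icc_self).clm_comp hF.continuousOn_A).neg
    (hF.integrable_bound.const_mul M) fun v hv => ?_
  rw [norm_neg]
  exact ((Z v).opNorm_comp_le _).trans (mul_le_mul (hM v (Ioc_subset_Icc_self hv))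
    (hF.norm_A_le hv) (norm_nonneg _) ((norm_nonneg _).trans (hM v (Ioc_subset_Icc_self hv))))

theorem IsRegularFamily.intervalIntegrable_comp_B {H : Type*} [NormedAddCommGroup H]
    [NormedSpace ℝ H] {F : H → EuclideanSpace ℝ (Fin d) → ℝ → EuclideanSpace ℝ (Fin d)} {κ : ℝ → ℝ}
    {h₀ : H} {A : ℝ → EuclideanSpace ℝ (Fin d) →L[ℝ] EuclideanSpace ℝ (Fin d)}
    {B : ℝ → H →L[ℝ] EuclideanSpace ℝ (Fin d)} (hF : IsRegularFamily T F κ h₀ x A B)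
    (hT : 0 < T) {Z : ℝ → EuclideanSpace ℝ (Fin d) →L[ℝ] EuclideanSpace ℝ (Fin d)}
    (hZc : ContinuousOn Z (Icc 0 T)) :
    IntervalIntegrable (fun v => (Z v).comp (B v)) volume 0 T := by
  obtain ⟨M, hM⟩ := isCompact_Icc.exists_bound_of_continuousOn hZc
  refine intervalIntegrable_of_continuousOn_Ioc hT.le
    ((hZc.mono Ioc_subset_Icc_self).clm_comp hF.continuousOn_B)
    (hF.integrable_bound.const_mul M) fun v hv => ?_
  exact ((Z v).opNorm_comp_le _).trans (mul_le_mul (hM v (Ioc_subset_Icc_self hv))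
    (hF.norm_B_le hv) (norm_nonneg _) ((norm_nonneg _).trans (hM v (Ioc_subset_Icc_self hv))))

/-- Along a single realization of the noise, the adjoint states are the row vectors `ℓ Z(s)` and
`- ℓ ∫₀ˢ Z B`, where `ℓ` is the derivative of the loss at the final state. -/
theorem exists_adjointStates (hsch : IsNoiseSchedule T α σ) (hT : 0 < T)
    (hε : IsRegularNoiseModel T ε) {L : EuclideanSpace ℝ (Fin d) → ℝ} (hL : Differentiable ℝ L)
    {N : ℝ → EuclideanSpace ℝ (Fin d)}
    (hx : IsPathSolution (fun y u => sdeDrift T α σ ε θ y z u) N 0 T x)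
    {Φ : EuclideanSpace ℝ (Fin p) → EuclideanSpace ℝ (Fin m) → ℝ → EuclideanSpace ℝ (Fin d) →
      ℝ → EuclideanSpace ℝ (Fin d)}
    (hΦ : ∀ θ z, ∀ t ∈ Icc 0 T, ∀ y, Φ θ z t y t = y ∧
      IsPathSolution (fun x u => sdeDrift T α σ ε θ x z u) N 0 t (fun u => Φ θ z t y u)) :
    ∃ ax az aθ,
      (∀ s ∈ Icc 0 T, HasFDerivAt (fun y => L (Φ θ z s y 0)) (ax s) (x s) ∧
        HasFDerivAt (fun z' => L (Φ θ z' s (x s) 0)) (az s) z ∧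
        HasFDerivAt (fun θ' => L (Φ θ' z s (x s) 0)) (aθ s) θ) ∧
      ∀ t ∈ Icc 0 T,
        IsIntegralSolution t T ax
          (fun u => -(ax u).comp (fderiv ℝ (fun y => sdeDrift T α σ ε θ y z u) (x u))) ∧
        IsIntegralSolution t T az
          (fun u => -(ax u).comp (fderiv ℝ (fun z' => sdeDrift T α σ ε θ (x u) z' u) z)) ∧
        IsIntegralSolution t T aθ
          (fun u => -(ax u).comp (fderiv ℝ (fun θ' => sdeDrift T α σ ε θ' (x u) z u) θ)) := by
  obtain ⟨κz, hFz⟩ := exists_isRegularFamily_cond hsch hT hε hx.1 θ z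
  obtain ⟨κθ, hFθ⟩ := exists_isRegularFamily_param hsch hT hε hx.1 θ z
  obtain ⟨Z, hZc, hZi, hZ⟩ := hFz.exists_adjointFlow hT
  have hBz := hFz.intervalIntegrable_comp_B hT hZc
  have hBθ := hFθ.intervalIntegrable_comp_B hT hZc
  set ℓ := fderiv ℝ L (x 0) with hℓ
  refine ⟨fun s => ℓ.comp (Z s),
    fun s => ℓ.comp (∫ v in (0 : ℝ)..s,
      -(Z v).comp (fderiv ℝ (fun z' => sdeDrift T α σ ε θ (x v) z' v) z)),
    fun s => ℓ.comp (∫ v in (0 : ℝ)..s,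
      -(Z v).comp (fderiv ℝ (fun θ' => sdeDrift T α σ ε θ' (x v) z v) θ)),
    fun s hs => ⟨?_, ?_, ?_⟩, fun t ht => ⟨?_, ?_, ?_⟩⟩
  · obtain ⟨κ, hF⟩ := exists_isRegularFamily_state hsch hT hε hx.1 θ z (x s)
    obtain ⟨h0, h1⟩ := hF.hasFDerivAt_flow hs (hx.restrict hs) (Y := fun y u => Φ θ z s y u)
      (fun y => (hΦ θ z s hs y).2) (ContinuousLinearMap.id ℝ _)
      (fun y => by simp [(hΦ θ z s hs y).1]) hZc hZ
    have h2 : HasFDerivAt L ℓ (Φ θ z s (x s) 0) := by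
      rw [h0]; exact (hL _).hasFDerivAt
    refine (h2.comp (x s) h1).congr_fderiv ?_
    simp
  · obtain ⟨h0, h1⟩ := hFz.hasFDerivAt_flow hs (hx.restrict hs)
      (Y := fun z' u => Φ θ z' s (x s) u)
      (fun z' => (hΦ θ z' s hs (x s)).2) 0 (fun z' => by simp [(hΦ θ z' s hs (x s)).1]) hZc hZ
    have h2 : HasFDerivAt L ℓ (Φ θ z s (x s) 0) := by
      rw [h0]; exact (hL _).hasFDerivAt
    refine (h2.comp z h1).congr_fderiv ?_
    simp
  · obtain ⟨h0, h1⟩ := hFθ.hasFDerivAt_flow hs (hx.restrict hs)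
      (Y := fun θ' u => Φ θ' z s (x s) u)
      (fun θ' => (hΦ θ' z s hs (x s)).2) 0 (fun θ' => by simp [(hΦ θ' z s hs (x s)).1]) hZc hZ
    have h2 : HasFDerivAt L ℓ (Φ θ z s (x s) 0) := by
      rw [h0]; exact (hL _).hasFDerivAt
    refine (h2.comp θ h1).congr_fderiv ?_
    simp
  · refine (IsIntegralSolution.of_primitive ht hZi hZ
      (ContinuousLinearMap.compL ℝ (EuclideanSpace ℝ (Fin d)) (EuclideanSpace ℝ (Fin d)) ℝ ℓ)).congr
      ht.2 (fun _ _ => rfl) fun u _ => ?_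
    ext; simp
  · refine (IsIntegralSolution.of_primitive (c₀ := 0) ht hBz.neg (fun s _ => (zero_add _).symm)
      (ContinuousLinearMap.compL ℝ (EuclideanSpace ℝ (Fin m))
      (EuclideanSpace ℝ (Fin d)) ℝ ℓ)).congr ht.2 (fun _ _ => rfl) fun u _ => ?_
    ext; simp
  · refine (IsIntegralSolution.of_primitive (c₀ := 0) ht hBθ.neg (fun s _ => (zero_add _).symm)
      (ContinuousLinearMap.compL ℝ (EuclideanSpace ℝ (Fin p))
      (EuclideanSpace ℝ (Fin d)) ℝ ℓ)).congr ht.2 (fun _ _ => rfl) fun u _ => ?_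
    ext; simp

/-- The diffusion matrix depends on none of `x`, `z`, `θ`, so that the adjoint diffusion SDEs have
no noise term and are equations between paths. -/
theorem solvesAdjointSDE_iff {Ω : Type*} [MeasurableSpace Ω] {P : Measure Ω}
    {w : ℝ → Ω → EuclideanSpace ℝ (Fin d)} {x : ℝ → Ω → EuclideanSpace ℝ (Fin d)} {t : ℝ}
    (htT : t < T) {ax : ℝ → Ω → EuclideanSpace ℝ (Fin d) →L[ℝ] ℝ}
    {az : ℝ → Ω → EuclideanSpace ℝ (Fin m) →L[ℝ] ℝ}
    {aθ : ℝ → Ω → EuclideanSpace ℝ (Fin p) →L[ℝ] ℝ} :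
    SolvesAdjointSDE P w (sdeDrift T α σ ε) (sdeDiffusion T α σ) θ z x t T ax az aθ ↔
      ∀ᵐ ω ∂P,
        IsIntegralSolution t T (fun s => ax s ω) (fun u => -(ax u ω).comp
          (fderiv ℝ (fun y => sdeDrift T α σ ε θ y z u) (x u ω))) ∧
        IsIntegralSolution t T (fun s => az s ω) (fun u => -(ax u ω).comp
          (fderiv ℝ (fun z' => sdeDrift T α σ ε θ (x u ω) z' u) z)) ∧
        IsIntegralSolution t T (fun s => aθ s ω) (fun u => -(ax u ω).comp
          (fderiv ℝ (fun θ' => sdeDrift T α σ ε θ' (x u ω) z u) θ)) := by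
  have h0 : ∀ (H : Type) [NormedAddCommGroup H] [NormedSpace ℝ H]
      (a : EuclideanSpace ℝ (Fin d) →L[ℝ] ℝ)
      (D : H →L[ℝ] EuclideanSpace ℝ (Fin d) →L[ℝ] EuclideanSpace ℝ (Fin d)), D = 0 →
      adjointDiffusionTerm a D = 0 := by
    rintro H _ _ a D rfl
    ext
    simp [adjointDiffusionTerm]
  have h1 : (fun (u : ℝ) (ω : Ω) => adjointDiffusionTerm (ax u ω) (fderiv ℝ
      (fun y => sdeDiffusion T α σ θ y z u) (x u ω))) = fun _ _ => 0 := by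
    funext u ω
    exact h0 _ _ _ (fderiv_const_apply _)
  have h2 : (fun (u : ℝ) (ω : Ω) => adjointDiffusionTerm (ax u ω) (fderiv ℝ
      (fun z' => sdeDiffusion T α σ θ (x u ω) z' u) z)) = fun _ _ => 0 := by
    funext u ω
    exact h0 _ _ _ (fderiv_const_apply _)
  have h3 : (fun (u : ℝ) (ω : Ω) => adjointDiffusionTerm (ax u ω) (fderiv ℝ
      (fun θ' => sdeDiffusion T α σ θ' (x u ω) z u) θ)) = fun _ _ => 0 := by
    funext u ω
    exact h0 _ _ _ (fderiv_const_apply _)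
  constructor
  · rintro ⟨e1, e2, e3⟩
    rw [h1, solvesStratonovich_zero_iff htT] at e1
    rw [h2, solvesStratonovich_zero_iff htT] at e2
    rw [h3, solvesStratonovich_zero_iff htT] at e3
    filter_upwards [e1, e2, e3] with ω k1 k2 k3 using ⟨k1, k2, k3⟩
  · intro h
    refine ⟨?_, ?_, ?_⟩
    · rw [h1, solvesStratonovich_zero_iff htT]
      exact h.mono fun _ k => k.1
    · rw [h2, solvesStratonovich_zero_iff htT]
      exact h.mono fun _ k => k.2.1
    · rw [h3, solvesStratonovich_zero_iff htT]
      exact h.mono fun _ k => k.2.2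

end Model

end AdjointDiffusion

theorem mainTheorem5
    {Ω : Type*} [MeasurableSpace Ω] (P : Measure Ω) [IsProbabilityMeasure P]
    {d m p : ℕ} (T : ℝ) (hT : 0 < T)
    (α σ : ℝ → ℝ) (hsched : AdjointDiffusion.IsNoiseSchedule T α σ)
    (ε : EuclideanSpace ℝ (Fin p) → EuclideanSpace ℝ (Fin d) → EuclideanSpace ℝ (Fin m) → ℝ →
      EuclideanSpace ℝ (Fin d))
    (hε : AdjointDiffusion.IsRegularNoiseModel T ε)
    (L : EuclideanSpace ℝ (Fin d) → ℝ) (hL : Differentiable ℝ L)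
    (W : ℝ≥0 → Ω → EuclideanSpace ℝ (Fin d)) (hW : AdjointDiffusion.IsWienerProcess P W)
    (θ : EuclideanSpace ℝ (Fin p)) (z : EuclideanSpace ℝ (Fin m))
    -- `N` is the noise term `∫ g dw̄` of the diffusion SDE
    (N : ℝ → Ω → EuclideanSpace ℝ (Fin d))
    (hN : AdjointDiffusion.IsBackwardItoProcess P (AdjointDiffusion.reverseWiener T W)
      (fun u _ => AdjointDiffusion.diffusionCoeff T α σ u •
        ContinuousLinearMap.id ℝ (EuclideanSpace ℝ (Fin d))) T N)
    -- `x` solves the diffusion SDE `dx = [f x + (g² / σ) ε_θ(x, z, t)] dt + g dw̄`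
    (x : ℝ → Ω → EuclideanSpace ℝ (Fin d))
    (hx : ∀ᵐ ω ∂P, AdjointDiffusion.IsPathSolution
      (fun y u => AdjointDiffusion.sdeDrift T α σ ε θ y z u) (fun u => N u ω) 0 T (fun u => x u ω))
    -- `Φ` is the stochastic flow of the diffusion SDE
    (Φ : EuclideanSpace ℝ (Fin p) → EuclideanSpace ℝ (Fin m) → ℝ → EuclideanSpace ℝ (Fin d) →
      ℝ → Ω → EuclideanSpace ℝ (Fin d))
    (hΦ : AdjointDiffusion.IsStochasticFlow P (AdjointDiffusion.sdeDrift T α σ ε) N T Φ)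
    (t : ℝ) (ht : t ∈ Ioo 0 T) :
    -- the adjoint states `∂L/∂x_t`, `∂L/∂z`, `∂L/∂θ` exist and solve the adjoint diffusion SDEs
    (∀ᵐ ω ∂P, ∀ s ∈ Icc 0 T,
      DifferentiableAt ℝ (fun y => L (Φ θ z s y 0 ω)) (x s ω) ∧
      DifferentiableAt ℝ (fun z' => L (Φ θ z' s (x s ω) 0 ω)) z ∧
      DifferentiableAt ℝ (fun θ' => L (Φ θ' z s (x s ω) 0 ω)) θ) ∧
    AdjointDiffusion.SolvesAdjointSDE P (AdjointDiffusion.reverseWiener T W)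
      (AdjointDiffusion.sdeDrift T α σ ε) (AdjointDiffusion.sdeDiffusion T α σ) θ z x t T
      (AdjointDiffusion.adjointX L Φ θ z x) (AdjointDiffusion.adjointZ L Φ θ z x)
      (AdjointDiffusion.adjointTheta L Φ θ z x) ∧
    -- for all initial values at time `t` the adjoint diffusion SDEs have a solution on `[t, T]`
    (∀ (bx : Ω → EuclideanSpace ℝ (Fin d) →L[ℝ] ℝ) (bz : Ω → EuclideanSpace ℝ (Fin m) →L[ℝ] ℝ)
        (bθ : Ω → EuclideanSpace ℝ (Fin p) →L[ℝ] ℝ),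
      ∃ ax az aθ,
        AdjointDiffusion.SolvesAdjointSDE P (AdjointDiffusion.reverseWiener T W)
          (AdjointDiffusion.sdeDrift T α σ ε) (AdjointDiffusion.sdeDiffusion T α σ) θ z x t T
          ax az aθ ∧
        ax t = bx ∧ az t = bz ∧ aθ t = bθ) ∧
    -- which is unique
    (∀ ax az aθ ax' az' aθ',
      AdjointDiffusion.SolvesAdjointSDE P (AdjointDiffusion.reverseWiener T W)
        (AdjointDiffusion.sdeDrift T α σ ε) (AdjointDiffusion.sdeDiffusion T α σ) θ z x t T
        ax az aθ →
      AdjointDiffusion.SolvesAdjointSDE P (AdjointDiffusion.reverseWiener T W)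
        (AdjointDiffusion.sdeDrift T α σ ε) (AdjointDiffusion.sdeDiffusion T α σ) θ z x t T
        ax' az' aθ' →
      (∀ᵐ ω ∂P, ax t ω = ax' t ω ∧ az t ω = az' t ω ∧ aθ t ω = aθ' t ω) →
      ∀ᵐ ω ∂P, ∀ s ∈ Icc t T, ax s ω = ax' s ω ∧ az s ω = az' s ω ∧ aθ s ω = aθ' s ω) ∧
    -- and every solution is given by the exact formulas
    (∀ ax az aθ,
      AdjointDiffusion.SolvesAdjointSDE P (AdjointDiffusion.reverseWiener T W)
        (AdjointDiffusion.sdeDrift T α σ ε) (AdjointDiffusion.sdeDiffusion T α σ) θ z x t T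
        ax az aθ →
      ∀ᵐ ω ∂P, ∀ s ∈ Ioc t T,
        (IntervalIntegrable (fun l =>
            (α (AdjointDiffusion.timeOfLogSNR T α σ l) ^ 2 * Real.exp (-l)) •
              (ax (AdjointDiffusion.timeOfLogSNR T α σ l) ω).comp
                (fderiv ℝ (fun y => ε θ y z (AdjointDiffusion.timeOfLogSNR T α σ l))
                  (x (AdjointDiffusion.timeOfLogSNR T α σ l) ω)))
            volume (AdjointDiffusion.halfLogSNR α σ t) (AdjointDiffusion.halfLogSNR α σ s) ∧
          ax s ω = (α t / α s) • ax t ω + (2 / α s) •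
            ∫ l in (AdjointDiffusion.halfLogSNR α σ t)..(AdjointDiffusion.halfLogSNR α σ s),
              (α (AdjointDiffusion.timeOfLogSNR T α σ l) ^ 2 * Real.exp (-l)) •
                (ax (AdjointDiffusion.timeOfLogSNR T α σ l) ω).comp
                  (fderiv ℝ (fun y => ε θ y z (AdjointDiffusion.timeOfLogSNR T α σ l))
                    (x (AdjointDiffusion.timeOfLogSNR T α σ l) ω))) ∧
        (IntervalIntegrable (fun l =>
            (α (AdjointDiffusion.timeOfLogSNR T α σ l) * Real.exp (-l)) •
              (ax (AdjointDiffusion.timeOfLogSNR T α σ l) ω).comp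
                (fderiv ℝ (fun z' => ε θ (x (AdjointDiffusion.timeOfLogSNR T α σ l) ω) z'
                  (AdjointDiffusion.timeOfLogSNR T α σ l)) z))
            volume (AdjointDiffusion.halfLogSNR α σ t) (AdjointDiffusion.halfLogSNR α σ s) ∧
          az s ω = az t ω + (2 : ℝ) •
            ∫ l in (AdjointDiffusion.halfLogSNR α σ t)..(AdjointDiffusion.halfLogSNR α σ s),
              (α (AdjointDiffusion.timeOfLogSNR T α σ l) * Real.exp (-l)) •
                (ax (AdjointDiffusion.timeOfLogSNR T α σ l) ω).comp
                  (fderiv ℝ (fun z' => ε θ (x (AdjointDiffusion.timeOfLogSNR T α σ l) ω) z'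
                    (AdjointDiffusion.timeOfLogSNR T α σ l)) z)) ∧
        (IntervalIntegrable (fun l =>
            (α (AdjointDiffusion.timeOfLogSNR T α σ l) * Real.exp (-l)) •
              (ax (AdjointDiffusion.timeOfLogSNR T α σ l) ω).comp
                (fderiv ℝ (fun θ' => ε θ' (x (AdjointDiffusion.timeOfLogSNR T α σ l) ω) z
                  (AdjointDiffusion.timeOfLogSNR T α σ l)) θ))
            volume (AdjointDiffusion.halfLogSNR α σ t) (AdjointDiffusion.halfLogSNR α σ s) ∧
          aθ s ω = aθ t ω + (2 : ℝ) •
            ∫ l in (AdjointDiffusion.halfLogSNR α σ t)..(AdjointDiffusion.halfLogSNR α σ s),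
              (α (AdjointDiffusion.timeOfLogSNR T α σ l) * Real.exp (-l)) •
                (ax (AdjointDiffusion.timeOfLogSNR T α σ l) ω).comp
                  (fderiv ℝ (fun θ' => ε θ' (x (AdjointDiffusion.timeOfLogSNR T α σ l) ω) z
                    (AdjointDiffusion.timeOfLogSNR T α σ l)) θ))) := by
  have hadj : ∀ᵐ ω ∂P, ContinuousOn (fun u => x u ω) (Icc 0 T) := hx.mono fun ω h => h.1
  have ht0 : t ∈ Icc 0 T := Ioo_subset_Icc_self ht
  have hsub : Icc t T ⊆ Ioc 0 T := fun u hu => ⟨ht.1.trans_le hu.1, hu.2⟩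
  have hIcc : Ioc 0 T ⊆ Icc 0 T := Ioc_subset_Icc_self
  refine ⟨?_, ?_, ?_, ?_, ?_⟩
  · filter_upwards [hx, hΦ] with ω h1 h2
    obtain ⟨ax, az, aθ, hd, -⟩ := AdjointDiffusion.exists_adjointStates hsched hT hε hL h1
      (θ := θ) (z := z) (Φ := fun θ z t y u => Φ θ z t y u ω) h2
    intro s hs
    obtain ⟨d1, d2, d3⟩ := hd s hs
    exact ⟨d1.differentiableAt, d2.differentiableAt, d3.differentiableAt⟩
  · rw [AdjointDiffusion.solvesAdjointSDE_iff ht.2]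
    filter_upwards [hx, hΦ] with ω h1 h2
    obtain ⟨ax, az, aθ, hd, hsol⟩ := AdjointDiffusion.exists_adjointStates hsched hT hε hL h1
      (θ := θ) (z := z) (Φ := fun θ z t y u => Φ θ z t y u ω) h2
    have e1 : ∀ u ∈ Icc t T, AdjointDiffusion.adjointX L Φ θ z x u ω = ax u :=
      fun u hu => (hd u (hIcc (hsub hu))).1.fderiv
    have e2 : ∀ u ∈ Icc t T, AdjointDiffusion.adjointZ L Φ θ z x u ω = az u :=
      fun u hu => (hd u (hIcc (hsub hu))).2.1.fderiv
    have e3 : ∀ u ∈ Icc t T, AdjointDiffusion.adjointTheta L Φ θ z x u ω = aθ u :=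
      fun u hu => (hd u (hIcc (hsub hu))).2.2.fderiv
    obtain ⟨s1, s2, s3⟩ := hsol t ht0
    exact ⟨s1.congr ht.2.le e1 fun u hu => by rw [e1 u hu],
      s2.congr ht.2.le e2 fun u hu => by rw [e1 u hu],
      s3.congr ht.2.le e3 fun u hu => by rw [e1 u hu]⟩
  · intro bx bz bθ
    -- the solution is chosen path by path, with the prescribed value at `t` on the null set too
    have hex : ∀ ω, ∃ ax : ℝ → EuclideanSpace ℝ (Fin d) →L[ℝ] ℝ,
        ∃ az : ℝ → EuclideanSpace ℝ (Fin m) →L[ℝ] ℝ,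
        ∃ aθ : ℝ → EuclideanSpace ℝ (Fin p) →L[ℝ] ℝ, ax t = bx ω ∧ az t = bz ω ∧ aθ t = bθ ω ∧
          (ContinuousOn (fun u => x u ω) (Icc 0 T) →
            AdjointDiffusion.IsIntegralSolution t T ax (fun u => -(ax u).comp (fderiv ℝ (fun y =>
              AdjointDiffusion.sdeDrift T α σ ε θ y z u) (x u ω))) ∧
            AdjointDiffusion.IsIntegralSolution t T az (fun u => -(ax u).comp (fderiv ℝ (fun z' =>
              AdjointDiffusion.sdeDrift T α σ ε θ (x u ω) z' u) z)) ∧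
            AdjointDiffusion.IsIntegralSolution t T aθ (fun u => -(ax u).comp (fderiv ℝ (fun θ' =>
              AdjointDiffusion.sdeDrift T α σ ε θ' (x u ω) z u) θ))) := by
      intro ω
      by_cases hc : ContinuousOn (fun u => x u ω) (Icc 0 T)
      · obtain ⟨ax, hx0, hax⟩ := AdjointDiffusion.IsIntegralSolution.exists_adjoint ht.2.le
          ((AdjointDiffusion.continuousOn_fderiv_sdeDrift_state (θ := θ) (z := z) hsched hT hε
            hc).mono hsub) (bx ω)
        obtain ⟨az, hz0, haz⟩ := AdjointDiffusion.IsIntegralSolution.exists_of_continuousOn ht.2.le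
          (hax.1.clm_comp ((AdjointDiffusion.continuousOn_fderiv_sdeDrift_cond (θ := θ) (z := z)
            hsched hε hc).mono hsub)).neg (bz ω)
        obtain ⟨aθ, hθ0, haθ⟩ := AdjointDiffusion.IsIntegralSolution.exists_of_continuousOn ht.2.le
          (hax.1.clm_comp ((AdjointDiffusion.continuousOn_fderiv_sdeDrift_param (θ := θ) (z := z)
            hsched hε hc).mono hsub)).neg (bθ ω)
        exact ⟨ax, az, aθ, hx0, hz0, hθ0, fun _ => ⟨hax, haz, haθ⟩⟩
      · exact ⟨fun _ => bx ω, fun _ => bz ω, fun _ => bθ ω, rfl, rfl, rfl, fun h => (hc h).elim⟩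
    choose ax az aθ h1 h2 h3 h4 using hex
    refine ⟨fun s ω => ax ω s, fun s ω => az ω s, fun s ω => aθ ω s, ?_, funext h1, funext h2,
      funext h3⟩
    rw [AdjointDiffusion.solvesAdjointSDE_iff ht.2]
    filter_upwards [hadj] with ω hω using h4 ω hω
  · intro ax az aθ ax' az' aθ' h h' h0
    rw [AdjointDiffusion.solvesAdjointSDE_iff ht.2] at h h'
    filter_upwards [hadj, h, h', h0] with ω hc hω hω' h0ω s hs
    have hx' : ∀ u ∈ Icc t T, ax u ω = ax' u ω := fun u hu =>
      AdjointDiffusion.IsIntegralSolution.adjoint_unique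
        ((AdjointDiffusion.continuousOn_fderiv_sdeDrift_state hsched hT hε hc).mono hsub)
        hω.1 hω'.1 h0ω.1 hu
    have hus : Set.uIcc t s ⊆ Icc t T := by
      rw [uIcc_of_le hs.1]; exact Icc_subset_Icc_right hs.2
    refine ⟨hx' s hs, (hω.2.1.2 s hs).2.trans (Eq.trans ?_ (hω'.2.1.2 s hs).2.symm),
      (hω.2.2.2 s hs).2.trans (Eq.trans ?_ (hω'.2.2.2 s hs).2.symm)⟩
    · exact congrArg₂ _ h0ω.2.1
        (intervalIntegral.integral_congr fun u hu => by simp only [hx' u (hus hu)])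
    · exact congrArg₂ _ h0ω.2.2
        (intervalIntegral.integral_congr fun u hu => by simp only [hx' u (hus hu)])
  · intro ax az aθ h
    rw [AdjointDiffusion.solvesAdjointSDE_iff ht.2] at h
    filter_upwards [hadj, h] with ω hc hω s hs
    have hsub' : Icc t T ⊆ Icc 0 T := hsub.trans hIcc
    refine ⟨hsched.adjoint_state_formula (a := fun u => ax u ω)
        (D := fun u => fderiv ℝ (fun y => ε θ y z u) (x u ω)) ht.1 hs
        ((hε.continuousOn_fderiv_x_comp hc).mono hsub')
        (hω.1.congr ht.2.le (fun _ _ => rfl) fun u hu => ?_),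
      hsched.adjoint_param_formula (a := fun u => ax u ω) (c := fun u => az u ω)
        (B := fun u => fderiv ℝ (fun z' => ε θ (x u ω) z' u) z) ht.1 hs hω.1.1
        ((hε.continuousOn_fderiv_z_comp hc).mono hsub')
        (hω.2.1.congr ht.2.le (fun _ _ => rfl) fun u hu => ?_),
      hsched.adjoint_param_formula (a := fun u => ax u ω) (c := fun u => aθ u ω)
        (B := fun u => fderiv ℝ (fun θ' => ε θ' (x u ω) z u) θ) ht.1 hs hω.1.1
        ((hε.continuousOn_fderiv_theta_comp hc).mono hsub')
        (hω.2.2.congr ht.2.le (fun _ _ => rfl) fun u hu => ?_)⟩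
    · rw [AdjointDiffusion.fderiv_sdeDrift_state hε (hsub' hu)]
    · rw [AdjointDiffusion.fderiv_sdeDrift_cond hε (hsub' hu)]
    · rw [AdjointDiffusion.fderiv_sdeDrift_param hε (hsub' hu)]
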